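/- All graphs are finite, simple and undirected. A class $\mathcal X$ of graphs is \emph{hereditary} if it is closed under isomorphism and deletion of vertices. The \emph{coloring problem} is to decide, for a given graph $G$ and a given number $k$, whether $\chi(G)\le k$. The class $\mathcal X$ is \emph{easy for the coloring problem} if $\mathcal X$ is hereditary and there is a Turing machine that, on every input $(G,k)$ with $G\in\mathcal X$ ($G$ given by its adjacency matrix and $k$ in binary), decides whether $\chi(G)\le k$ in a number of steps bounded by a polynomial in the length of the input. A \emph{clique separator} of a graph is a clique whose removal increases the number of connected components. A \emph{C-block} of a graph $G$ is a (with respect to inclusion) maximal connected induced subgraph of $G$ that has no clique separator; here the graph without vertices counts as connected. The \emph{C-closure} $[\mathcal X]_C$ is the class of all graphs whose every C-block belongs to $\mathcal X$. \textbf{Theorem.} If a class $\mathcal X$ is easy for the coloring problem, then so is its C-closure $[\mathcal X]_C$; that is, $[\mathcal X]_C$ is hereditary and the coloring problem can be solved in polynomial time on it. -/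

import Mathlib

/-- A class of finite graphs: a property of graphs with a finite vertex type. (Closure under
isomorphism is part of `GraphClass.Hereditary`.) -/
abbrev GraphClass : Type 1 := ∀ (V : Type) [Finite V], SimpleGraph V → Prop

/-- A class is hereditary if it is closed under isomorphism and deletion of vertices, that is,
if it contains every graph that is isomorphic to an induced subgraph of one of its members
(`H ↪g G` is an embedding that preserves and reflects adjacency). -/
def GraphClass.Hereditary (X : GraphClass) : Prop :=
  ∀ (V W : Type) [Finite V] [Finite W] (G : SimpleGraph V) (H : SimpleGraph W),
    X V G → Nonempty (H ↪g G) → X W H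

/-- `Q` is a clique separator of `G`: a clique whose removal increases the number of
connected components. -/
def IsCliqueSeparator {V : Type} (G : SimpleGraph V) (Q : Set V) : Prop :=
  G.IsClique Q ∧ Nat.card G.ConnectedComponent < Nat.card (G.induce Qᶜ).ConnectedComponent

/-- `G` is connected (the graph without vertices is allowed) and has no clique separator. -/
def IsCliqueAtom {V : Type} (G : SimpleGraph V) : Prop :=
  G.Preconnected ∧ ∀ Q : Set V, ¬ IsCliqueSeparator G Q

/-- `S` is the vertex set of a C-block of `G`, a maximal connected induced subgraph
without clique separators. -/
def IsCBlock {V : Type} (G : SimpleGraph V) (S : Set V) : Prop :=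
  Maximal (fun T : Set V => IsCliqueAtom (G.induce T)) S

/-- The C-closure of `X`: all graphs whose every C-block belongs to `X`. -/
def CClosure (X : GraphClass) : GraphClass :=
  fun V _ G => ∀ S : Set V, IsCBlock G S → X S (G.induce S)

/-- An instance of the coloring problem: a graph with vertices `0, …, n - 1` and a number `k`. -/
structure ColoringInstance where
  n : ℕ
  graph : SimpleGraph (Fin n)
  k : ℕ

/-- The input word of an instance over the three-letter alphabet `Option Bool`, with `none` as the
end-of-row mark: the rows of the adjacency matrix one after another, each followed by `none`,
and then the number `k` in binary. -/
noncomputable def ColoringInstance.encode (I : ColoringInstance) : List (Option Bool) :=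
  open scoped Classical in
  (List.finRange I.n).flatMap
      (fun i => (List.finRange I.n).map (fun j => some (decide (I.graph.Adj i j))) ++ [none])
    ++ (Computability.encodeNat I.k).map some

/-- The answer to an instance of the coloring problem: whether `χ(G) ≤ k`. -/
noncomputable def ColoringInstance.answer (I : ColoringInstance) : Bool :=
  open scoped Classical in decide (I.graph.chromaticNumber ≤ (I.k : ℕ∞))

/-- The coloring problem can be solved in polynomial time for graphs in `X`: some Turing machine
outputs the correct answer, within a number of steps polynomial in the length of the input, on all
instances whose graph lies in `X`. (Nothing is required of it on other inputs.) -/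
def ColoringInPolyTime (X : GraphClass) : Prop :=
  Nonempty (Turing.TM2ComputableInPolyTime
    (fun I : {I : ColoringInstance // X (Fin I.n) I.graph} => I.1.encode)
    Computability.encodeBool
    (fun I => I.1.answer))

/-- `X` is easy for the coloring problem. -/
def EasyForColoring (X : GraphClass) : Prop :=
  X.Hereditary ∧ ColoringInPolyTime X

/-!
Call two vertices of a graph *inseparable* if no clique separates them. Atoms (connected graphs
without clique separators) are the vertex sets whose elements are pairwise inseparable within the
set, and every set of vertices that are pairwise inseparable in the whole graph `G` lies in an atom
(`exists_isCliqueAtom_superset`). Every atom of an induced subgraph is an atom of the whole graph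
and lies in one of its C-blocks, so the C-closure of a hereditary class is hereditary
(`CClosure.hereditary`). And since colorings of two parts that meet in a clique can be glued, `G` is
`k`-colorable if and only if all its atoms are (`colorable_of_atoms`).

To find vertex sets that do for the atoms, consider bypass-closed relations `F`: they contain
adjacency, and whenever `u` and `v` are `F`-neighbours of `w` joined by an `F`-walk with all inner
vertices outside the closed neighbourhood of `w` in `G`, they contain the pair `u`, `v`. The least
such relation consists of inseparable pairs, because a clique that separates `u` from `v` would have
to contain `w`, and then the walk could not pass the clique. Conversely, if `F` is bypass-closed,
then pairs outside `F` are separated by a clique (`BypassClosed.cliqueSeparated`), and Dirac's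
argument for chordal graphs yields simplicial vertices (`BypassClosed.exists_simplicial`). So
repeated removal of simplicial vertices uses up all vertices, and the neighbourhoods that they have
at the time of their removal form at most `n` *tested sets*. Each tested set consists of inseparable
pairs, hence lies in an atom, and each nonempty atom, being a clique of `F`, lies in a tested set.
Therefore the graphs induced by the tested sets belong to the class `X` if `G` belongs to its
C-closure (`induce_testedSet_mem`), and `G` is `k`-colorable if and only if they all are
(`colorable_iff_testedSet`).

All relations involved are computed from adjacency by polynomially many first-order updates. These
are written in a small language of loop programs on Boolean matrices. Each such program compiles to
a piece of code for a stack machine that runs in polynomial time (`Prog.local_compile`). The final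
machine (`solve`, `runs_solve`) reads the input, computes the tested sets, feeds the encoding of
each induced subgraph to the machine given for `X`, which it contains as a subroutine
(`runs_callFrag`), and records whether some answer was negative.
-/

/-! ### Separation by cliques -/

/-- `u` and `v` are vertices of `G[W]` that lie on different sides of a clique `Q`: some set `P` of
vertices of `W`, disjoint from `Q`, contains `u` but not `v ∉ Q`, and no edge of `G[W]` leaves `P`
except to `Q`. -/
def CliqueSeparated {V : Type} (G : SimpleGraph V) (W : Set V) (u v : V) : Prop :=
  ∃ P Q : Set V, G.IsClique Q ∧ P ⊆ W ∧ Disjoint P Q ∧ u ∈ P ∧ v ∈ W ∧ v ∉ P ∧ v ∉ Q ∧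
    ∀ p ∈ P, ∀ r ∈ W, r ∉ P → r ∉ Q → ¬ G.Adj p r

theorem CliqueSeparated.symm {V : Type} {G : SimpleGraph V} {W : Set V} {u v : V}
    (h : CliqueSeparated G W u v) : CliqueSeparated G W v u := by
  obtain ⟨P, Q, hQ, hPW, hd, hu, hvW, hvP, hvQ, hE⟩ := h
  refine ⟨W \ (P ∪ Q), Q, hQ, Set.sdiff_subset, ?_, ⟨hvW, by simp [hvP, hvQ]⟩, hPW hu,
    fun h => h.2 (Or.inl hu), Set.disjoint_left.1 hd hu, ?_⟩
  · exact Set.disjoint_left.2 fun x hx hxQ => hx.2 (Or.inr hxQ)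
  · intro p hp r hr hr' hrQ hadj
    have hrP : r ∈ P := by
      by_contra hrP
      exact hr' ⟨hr, by simp [hrP, hrQ]⟩
    exact hE r hrP p hp.1 (fun h => hp.2 (Or.inl h)) (fun h => hp.2 (Or.inr h)) hadj.symm

theorem not_cliqueSeparated_of_adj {V : Type} {G : SimpleGraph V} {W : Set V} {u v : V}
    (h : G.Adj u v) : ¬ CliqueSeparated G W u v := by
  rintro ⟨P, Q, -, -, -, hu, hvW, hvP, hvQ, hE⟩
  exact hE u hu v hvW hvP hvQ h

theorem not_cliqueSeparated_self {V : Type} {G : SimpleGraph V} {W : Set V} {u : V} :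
    ¬ CliqueSeparated G W u u := by
  rintro ⟨P, Q, -, -, -, hu, -, hvP, -⟩
  exact hvP hu

theorem cliqueSeparated_induce_iff {V : Type} (G : SimpleGraph V) (T : Set V) (u v : T) :
    CliqueSeparated (G.induce T) Set.univ u v ↔ CliqueSeparated G T u v := by
  constructor
  · rintro ⟨P, Q, hQ, -, hd, hu, -, hvP, hvQ, hE⟩
    refine ⟨Subtype.val '' P, Subtype.val '' Q, ?_, ?_, ?_, ⟨u, hu, rfl⟩, v.2, ?_, ?_, ?_⟩
    · rintro _ ⟨a, ha, rfl⟩ _ ⟨b, hb, rfl⟩ hab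
      exact hQ ha hb fun h => hab (congrArg _ h)
    · rintro _ ⟨a, -, rfl⟩
      exact a.2
    · exact (Set.disjoint_image_iff Subtype.val_injective).2 hd
    · rintro ⟨a, ha, h⟩
      exact hvP (Subtype.ext h ▸ ha)
    · rintro ⟨a, ha, h⟩
      exact hvQ (Subtype.ext h ▸ ha)
    · rintro _ ⟨p, hp, rfl⟩ r hr hrP hrQ
      exact hE p hp ⟨r, hr⟩ trivial (fun h => hrP ⟨_, h, rfl⟩) (fun h => hrQ ⟨_, h, rfl⟩)
  · rintro ⟨P, Q, hQ, -, hd, hu, -, hvP, hvQ, hE⟩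
    refine ⟨Subtype.val ⁻¹' P, Subtype.val ⁻¹' Q, ?_, Set.subset_univ _, hd.preimage _, hu,
      trivial, hvP, hvQ, fun p hp r _ hrP hrQ => hE p hp r r.2 hrP hrQ⟩
    intro a ha b hb hab
    exact hQ ha hb fun h => hab (Subtype.ext h)

theorem isCliqueAtom_iff_univ {V : Type} [Finite V] (G : SimpleGraph V) :
    IsCliqueAtom G ↔ ∀ u v, ¬ CliqueSeparated G Set.univ u v := by
  constructor
  · rintro ⟨hG, hsep⟩ u v ⟨P, Q, hQ, -, hd, hu, -, hvP, hvQ, hE⟩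
    refine hsep Q ⟨hQ, ?_⟩
    have := hG.subsingleton_connectedComponent
    refine (Finite.card_le_one_iff_subsingleton.2 this).trans_lt
      (Finite.one_lt_card_iff_nontrivial.2 ?_)
    have huQ : u ∈ Qᶜ := Set.disjoint_left.1 hd hu
    refine ⟨(G.induce Qᶜ).connectedComponentMk ⟨u, huQ⟩,
      (G.induce Qᶜ).connectedComponentMk ⟨v, hvQ⟩, fun h => ?_⟩
    have hr := (SimpleGraph.reachable_iff_reflTransGen _ _).1
      (SimpleGraph.ConnectedComponent.exact h)
    have key : ∀ x : (Qᶜ : Set V),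
        Relation.ReflTransGen (G.induce Qᶜ).Adj ⟨u, huQ⟩ x → (x : V) ∈ P := by
      intro x hx
      induction hx with
      | refl => exact hu
      | @tail b c _ hbc ih =>
        by_contra hc
        exact hE b ih c trivial hc c.2 hbc
    exact hvP (key _ hr)
  · intro h
    refine ⟨fun u v => ?_, fun Q ⟨hQ, hlt⟩ => ?_⟩
    · by_contra huv
      refine h u v ⟨{x | G.Reachable u x}, ∅, by simp, Set.subset_univ _, by simp,
        SimpleGraph.Reachable.refl _, trivial, huv, by simp, ?_⟩
      intro p hp r _ hr _ hadj
      exact hr (SimpleGraph.Reachable.trans hp hadj.reachable)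
    · have hne : 0 < Nat.card G.ConnectedComponent := by
        have h0 : Nonempty (G.induce Qᶜ).ConnectedComponent :=
          (Nat.card_pos_iff.1 (Nat.zero_lt_of_lt hlt)).1
        obtain ⟨c⟩ := h0
        obtain ⟨x, -⟩ := c.exists_rep
        have : Nonempty G.ConnectedComponent := ⟨G.connectedComponentMk x⟩
        exact Finite.card_pos
      obtain ⟨c, d, hcd⟩ := Finite.one_lt_card_iff_nontrivial.1 (lt_of_le_of_lt hne hlt)
      obtain ⟨u, rfl⟩ := c.exists_rep
      obtain ⟨v, rfl⟩ := d.exists_rep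
      refine h u v ⟨{x | ∃ hx : x ∈ Qᶜ, (G.induce Qᶜ).Reachable u ⟨x, hx⟩}, Q, hQ,
        Set.subset_univ _, Set.disjoint_left.2 fun x hx => hx.1,
        ⟨u.2, SimpleGraph.Reachable.refl _⟩, trivial, ?_, v.2, ?_⟩
      · rintro ⟨hx, hr⟩
        exact hcd (SimpleGraph.ConnectedComponent.sound hr)
      · rintro p ⟨hp, hr⟩ r _ hrP hrQ hadj
        refine hrP ⟨hrQ, hr.trans (SimpleGraph.Adj.reachable ?_)⟩
        exact hadj

/-- Atoms are the vertex sets no two vertices of which are separated by a clique. -/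
theorem isCliqueAtom_induce_iff {V : Type} [Finite V] (G : SimpleGraph V) (T : Set V) :
    IsCliqueAtom (G.induce T) ↔ ∀ u ∈ T, ∀ v ∈ T, ¬ CliqueSeparated G T u v := by
  rw [isCliqueAtom_iff_univ]
  simp only [cliqueSeparated_induce_iff, Subtype.forall]

/-- If `W` is the union of `A` and `B`, glued along a clique, then a clique separating two vertices
inside `A` also separates them inside `W`. -/
theorem CliqueSeparated.of_side {V : Type} {G : SimpleGraph V} {A B : Set V} {x y : V}
    (hAB : G.IsClique (A ∩ B)) (hE : ∀ a ∈ A \ B, ∀ b ∈ B \ A, ¬ G.Adj a b)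
    (h : CliqueSeparated G A x y) : CliqueSeparated G (A ∪ B) x y := by
  obtain ⟨P, Q, hQ, hPA, hd, hx, hyA, hyP, hyQ, hPE⟩ := h
  by_cases hPB : (P ∩ B).Nonempty
  · -- the clique `A ∩ B` meets `P`, so it lies in `P ∪ Q` and the rest of `B` can join `P`
    obtain ⟨p, hp, hpB⟩ := hPB
    have hsub : ∀ z ∈ A ∩ B, z ∈ P ∨ z ∈ Q := by
      intro z hz
      by_contra hcon
      push Not at hcon
      refine hPE p hp z hz.1 hcon.1 hcon.2 (hAB ⟨hPA hp, hpB⟩ hz ?_)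
      rintro rfl
      exact hcon.1 hp
    refine ⟨P ∪ (B \ A), Q ∩ A, hQ.subset Set.inter_subset_left, ?_, ?_, Or.inl hx, Or.inl hyA, ?_,
      fun h => hyQ h.1, ?_⟩
    · exact Set.union_subset (hPA.trans Set.subset_union_left)
        (Set.sdiff_subset.trans Set.subset_union_right)
    · refine Set.disjoint_left.2 ?_
      rintro z (hz | hz) ⟨hzQ, hzA⟩
      · exact Set.disjoint_left.1 hd hz hzQ
      · exact hz.2 hzA
    · rintro (h | h)
      · exact hyP h
      · exact h.2 hyA
    · intro q hq r hr hrP hrQ hadj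
      have hrA : r ∈ A := by
        rcases hr with h | h
        · exact h
        · by_contra hrA
          exact hrP (Or.inr ⟨h, hrA⟩)
      have hrP' : r ∉ P := fun h => hrP (Or.inl h)
      have hrQ' : r ∉ Q := fun h => hrQ ⟨h, hrA⟩
      rcases hq with hq | hq
      · exact hPE q hq r hrA hrP' hrQ' hadj
      · have hrB : r ∉ B := fun h => (hsub r ⟨hrA, h⟩).elim hrP' hrQ'
        exact hE r ⟨hrA, hrB⟩ q hq hadj.symm
  · refine ⟨P, Q, hQ, hPA.trans Set.subset_union_left, hd, hx, Or.inl hyA, hyP, hyQ, ?_⟩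
    intro p hp r hr hrP hrQ
    by_cases hrA : r ∈ A
    · exact hPE p hp r hrA hrP hrQ
    · exact hE p ⟨hPA hp, fun h => hPB ⟨p, hp, h⟩⟩ r ⟨hr.resolve_left hrA, hrA⟩

/-- The two sides of a separation. -/
theorem CliqueSeparated.exists_sides {V : Type} {G : SimpleGraph V} {W : Set V} {u v : V}
    (h : CliqueSeparated G W u v) :
    ∃ A B : Set V, A ∪ B = W ∧ u ∉ B ∧ v ∉ A ∧ u ∈ A ∧ v ∈ B ∧ G.IsClique (A ∩ B) ∧
      ∀ a ∈ A \ B, ∀ b ∈ B \ A, ¬ G.Adj a b := by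
  obtain ⟨P, Q, hQ, hPW, hd, hu, hvW, hvP, hvQ, hE⟩ := h
  refine ⟨P ∪ (Q ∩ W), W \ P, ?_, fun h => h.2 hu, by simp [hvP, hvQ], Or.inl hu, ⟨hvW, hvP⟩,
    hQ.subset ?_, ?_⟩
  · ext z
    have := @hPW z
    simp only [Set.mem_union, Set.mem_inter_iff, Set.mem_sdiff]
    tauto
  · rintro z ⟨h | h, h'⟩
    · exact (h'.2 h).elim
    · exact h.1
  · rintro a ⟨ha | ha, ha'⟩ b ⟨hb, hb'⟩
    · exact hE a ha b hb.1 hb.2 fun h => hb' (Or.inr ⟨h, hb.1⟩)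
    · have haP : a ∈ P := by
        by_contra haP
        exact ha' ⟨ha.2, haP⟩
      exact (Set.disjoint_left.1 hd haP ha.1).elim

/-- A set of vertices that are pairwise not separated by cliques lies in an atom. -/
theorem exists_isCliqueAtom_superset {V : Type} [Finite V] (G : SimpleGraph V) (K W : Set V)
    (hKW : K ⊆ W) (hK : ∀ u ∈ K, ∀ v ∈ K, ¬ CliqueSeparated G W u v) :
    ∃ T, K ⊆ T ∧ IsCliqueAtom (G.induce T) := by
  induction hn : W.ncard using Nat.strong_induction_on generalizing W with
  | _ n ih =>
    subst hn
    by_cases hW : IsCliqueAtom (G.induce W)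
    · exact ⟨W, hKW, hW⟩
    rw [isCliqueAtom_induce_iff] at hW
    push Not at hW
    obtain ⟨u, hu, v, hv, huv⟩ := hW
    obtain ⟨A, B, rfl, huB, hvA, -, -, hQ, hE⟩ := huv.exists_sides
    have hside : K ⊆ A ∨ K ⊆ B := by
      by_contra hcon
      rw [not_or, Set.not_subset, Set.not_subset] at hcon
      obtain ⟨⟨b, hb, hbA⟩, a, ha, haB⟩ := hcon
      refine hK a ha b hb ⟨A \ B, A ∩ B, hQ, Set.sdiff_subset.trans Set.subset_union_left, ?_,
        ⟨(hKW ha).resolve_right haB, haB⟩, hKW hb, fun h => hbA h.1, fun h => hbA h.1, ?_⟩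
      · exact Set.disjoint_left.2 fun z hz hz' => hz.2 hz'.2
      · intro p hp r hr hrP hrQ
        refine hE p hp r ?_
        rcases hr with hr | hr
        · by_cases hrB : r ∈ B
          · exact (hrQ ⟨hr, hrB⟩).elim
          · exact (hrP ⟨hr, hrB⟩).elim
        · exact ⟨hr, fun h => hrQ ⟨h, hr⟩⟩
    rcases hside with h | h
    · refine ih A.ncard (Set.ncard_lt_ncard ⟨Set.subset_union_left, fun h => hvA (h hv)⟩) A h
        (fun x hx y hy hxy => hK x hx y hy (hxy.of_side hQ hE)) rfl
    · refine ih B.ncard (Set.ncard_lt_ncard ⟨Set.subset_union_right, fun h => huB (h hu)⟩) B h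
        (fun x hx y hy hxy => hK x hx y hy ?_) rfl
      rw [Set.union_comm]
      exact hxy.of_side (by rwa [Set.inter_comm]) fun a ha b hb hab => hE b hb a ha hab.symm

/-- Colorings of two sides that meet in a clique can be glued. -/
theorem colorable_induce_union {V : Type} [Finite V] {G : SimpleGraph V} {A B : Set V} {k : ℕ}
    (hAB : G.IsClique (A ∩ B)) (hE : ∀ a ∈ A \ B, ∀ b ∈ B \ A, ¬ G.Adj a b)
    (hA : (G.induce A).Colorable k) (hB : (G.induce B).Colorable k) :
    (G.induce (A ∪ B)).Colorable k := by
  classical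
  obtain ⟨f⟩ := hA
  obtain ⟨g⟩ := hB
  obtain ⟨π, hπ⟩ := Equiv.Perm.exists_extending_pair
    (fun x : (A ∩ B : Set V) => g ⟨x, x.2.2⟩) (fun x : (A ∩ B : Set V) => f ⟨x, x.2.1⟩)
    (by
      intro x y hxy
      by_contra hne
      exact g.valid (v := ⟨x, x.2.2⟩) (w := ⟨y, y.2.2⟩)
        (hAB x.2 y.2 fun h => hne (Subtype.ext h)) hxy)
    (by
      intro x y hxy
      by_contra hne
      exact f.valid (v := ⟨x, x.2.1⟩) (w := ⟨y, y.2.1⟩)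
        (hAB x.2 y.2 fun h => hne (Subtype.ext h)) hxy)
  let c : (A ∪ B : Set V) → Fin k := fun x =>
    if h : (x : V) ∈ A then f ⟨x, h⟩ else π (g ⟨x, x.2.resolve_left h⟩)
  have cA : ∀ (x : (A ∪ B : Set V)) (h : (x : V) ∈ A), c x = f ⟨x, h⟩ := fun x h => by
    simp only [c, h, dite_true]
  have cB : ∀ (x : (A ∪ B : Set V)) (h : (x : V) ∈ B), c x = π (g ⟨x, h⟩) := fun x h => by
    by_cases hA : (x : V) ∈ A
    · rw [cA x hA]
      exact (hπ ⟨x, hA, h⟩).symm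
    · simp only [c, hA, dite_false]
  refine ⟨SimpleGraph.Coloring.mk c ?_⟩
  intro x y hxy
  have hxy' : G.Adj x y := hxy
  by_cases hA : (x : V) ∈ A ∧ (y : V) ∈ A
  · rw [cA x hA.1, cA y hA.2]
    exact f.valid hxy'
  by_cases hB : (x : V) ∈ B ∧ (y : V) ∈ B
  · rw [cB x hB.1, cB y hB.2]
    exact fun h => g.valid (v := ⟨x, hB.1⟩) (w := ⟨y, hB.2⟩) hxy' (π.injective h)
  exfalso
  have hx := x.2
  have hy := y.2
  simp only [Set.mem_union] at hx hy
  by_cases hxA : (x : V) ∈ A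
  · exact hE x ⟨hxA, by tauto⟩ y ⟨by tauto, by tauto⟩ hxy'
  · exact hE y ⟨by tauto, by tauto⟩ x ⟨by tauto, by tauto⟩ hxy'.symm

/-- A graph is `k`-colorable if all its atoms are. -/
theorem colorable_of_atoms {V : Type} [Finite V] (G : SimpleGraph V) (k : ℕ) (W : Set V)
    (h : ∀ T ⊆ W, IsCliqueAtom (G.induce T) → (G.induce T).Colorable k) :
    (G.induce W).Colorable k := by
  induction hn : W.ncard using Nat.strong_induction_on generalizing W with
  | _ n ih =>
    subst hn
    by_cases hW : IsCliqueAtom (G.induce W)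
    · exact h W subset_rfl hW
    rw [isCliqueAtom_induce_iff] at hW
    push Not at hW
    obtain ⟨u, hu, v, hv, huv⟩ := hW
    obtain ⟨A, B, rfl, huB, hvA, -, -, hQ, hE⟩ := huv.exists_sides
    refine colorable_induce_union hQ hE ?_ ?_
    · exact ih _ (Set.ncard_lt_ncard ⟨Set.subset_union_left, fun h => hvA (h hv)⟩) A
        (fun T hT => h T (hT.trans Set.subset_union_left)) rfl
    · exact ih _ (Set.ncard_lt_ncard ⟨Set.subset_union_right, fun h => huB (h hu)⟩) B
        (fun T hT => h T (hT.trans Set.subset_union_right)) rfl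

theorem IsCliqueAtom.of_iso {V W : Type} [Finite V] [Finite W] {G : SimpleGraph V}
    {H : SimpleGraph W} (e : G ≃g H) (hG : IsCliqueAtom G) : IsCliqueAtom H := by
  rw [isCliqueAtom_iff_univ] at hG ⊢
  rintro u v ⟨P, Q, hQ, -, hd, hu, -, hvP, hvQ, hE⟩
  refine hG (e.symm u) (e.symm v) ⟨e ⁻¹' P, e ⁻¹' Q, ?_, Set.subset_univ _, hd.preimage _,
    by simpa using hu, trivial, by simpa using hvP, by simpa using hvQ, ?_⟩
  · intro a ha b hb hab
    exact e.map_adj_iff.1 (hQ ha hb (e.injective.ne hab))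
  · intro p hp r _ hrP hrQ hadj
    exact hE (e p) hp (e r) trivial hrP hrQ (e.map_adj_iff.2 hadj)

/-- Every atom lies in a C-block. -/
theorem exists_isCBlock_superset {V : Type} [Finite V] (G : SimpleGraph V) {T : Set V}
    (hT : IsCliqueAtom (G.induce T)) : ∃ S, T ⊆ S ∧ IsCBlock G S := by
  obtain ⟨S, hTS, hS⟩ := (Set.toFinite {T : Set V | IsCliqueAtom (G.induce T)}).exists_le_maximal hT
  exact ⟨S, hTS, hS⟩

/-- A member of the C-closure of a hereditary class has all its atoms in that class. -/
theorem CClosure.of_atom {X : GraphClass} (hX : X.Hereditary) {V : Type} [Finite V]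
    {G : SimpleGraph V} (hG : CClosure X V G) {T : Set V} (hT : IsCliqueAtom (G.induce T)) :
    X T (G.induce T) := by
  obtain ⟨S, hTS, hS⟩ := exists_isCBlock_superset G hT
  exact hX _ _ _ _ (hG S hS) ⟨G.induceHomOfLE hTS⟩

theorem CClosure.hereditary {X : GraphClass} (hX : X.Hereditary) : (CClosure X).Hereditary := by
  rintro V W _ _ G H hG ⟨f⟩ S hS
  let T : Set V := f '' S
  let e : H.induce S ≃g G.induce T :=
    { toEquiv := Equiv.Set.image f S f.injective
      map_rel_iff' := f.map_adj_iff }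
  exact hX _ _ _ _ (CClosure.of_atom hX hG (hS.prop.of_iso e)) ⟨e.toEmbedding⟩

/-! ### The graph of pairs not separated by a clique -/

/-- One step of a walk along `F` to a vertex outside the closed neighbourhood of `w` in `G`. -/
def AvoidStep {V : Type} (G : SimpleGraph V) (F : V → V → Prop) (w x y : V) : Prop :=
  F x y ∧ ¬ G.Adj w y ∧ w ≠ y

/-- `u` and `v` are `F`-neighbours of `w`, and some `F`-walk from `u` to `v` has all its inner
vertices outside the closed neighbourhood of `w` in `G`. -/
def Bypass {V : Type} (G : SimpleGraph V) (F : V → V → Prop) (w u v : V) : Prop :=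
  F u w ∧ F w v ∧ ∃ x, Relation.ReflTransGen (AvoidStep G F w) u x ∧ F x v

/-- The reflexive and symmetric relations that contain adjacency in `G` and relate the ends of
every bypass. -/
structure BypassClosed {V : Type} (G : SimpleGraph V) (F : V → V → Prop) : Prop where
  refl : ∀ u, F u u
  symm : ∀ u v, F u v → F v u
  adj : ∀ u v, G.Adj u v → F u v
  bypass : ∀ w u v, Bypass G F w u v → F u v

/-- If no `F`-related pair is separated by a clique, then the ends of a bypass around `w` are not
separated either: a separating clique would contain `w`, hence would miss the walk. -/
theorem Bypass.not_cliqueSeparated {V : Type} {G : SimpleGraph V} {F : V → V → Prop}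
    (hF : ∀ u v, F u v → ¬ CliqueSeparated G Set.univ u v) {w u v : V} (h : Bypass G F w u v) :
    ¬ CliqueSeparated G Set.univ u v := by
  obtain ⟨huw, hwv, x, hux, hxv⟩ := h
  rintro ⟨P, Q, hQ, hP, hd, hu, -, hvP, hvQ, hE⟩
  have cross : ∀ a b, F a b → a ∈ P → b ∉ P → b ∉ Q → False := fun a b hab ha hb hb' =>
    hF a b hab ⟨P, Q, hQ, hP, hd, ha, trivial, hb, hb', hE⟩
  have hwP : w ∉ P := fun h => cross w v hwv h hvP hvQ
  have hwQ : w ∈ Q := by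
    by_contra h
    exact cross u w huw hu hwP h
  have key : x ∈ P := by
    clear hxv
    induction hux with
    | refl => exact hu
    | @tail b c _ hbc ih =>
      by_contra hc
      exact cross b c hbc.1 ih hc fun hcQ => hbc.2.1 (hQ hwQ hcQ hbc.2.2)
  exact cross x v hxv key hvP hvQ

/-- `x` lies in the component of `b` in the graph `F` restricted to `U`. -/
def InComp {V : Type} (F : V → V → Prop) (U : Set V) (b x : V) : Prop :=
  Relation.ReflTransGen (fun x y => F x y ∧ y ∈ U) b x

theorem InComp.mem {V : Type} {F : V → V → Prop} {U : Set V} {b x : V} (hb : b ∈ U)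
    (h : InComp F U b x) : x ∈ U := by
  cases h with
  | refl => exact hb
  | tail _ h => exact h.2

theorem InComp.symm {V : Type} {F : V → V → Prop} (hF : ∀ u v, F u v → F v u) {U : Set V} {b x : V}
    (hb : b ∈ U) (h : InComp F U b x) : InComp F U x b := by
  induction h with
  | refl => exact .refl
  | tail h1 h2 ih => exact .head ⟨hF _ _ h2.1, InComp.mem hb h1⟩ ih

/-- The neighbourhood of a component that avoids the neighbours of `a`, if it consists of
neighbours of `a`, is a clique. -/
theorem BypassClosed.clique_nbhd {V : Type} {G : SimpleGraph V} {F : V → V → Prop}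
    (hF : BypassClosed G F) {U : Set V} {a b x y c d : V} (hU : ∀ z ∈ U, ¬ F a z) (hb : b ∈ U)
    (hc : InComp F U b c) (hd : InComp F U b d) (hx : F a x) (hy : F a y)
    (hcx : F c x) (hdy : F d y) : F x y := by
  have havoid : ∀ z ∈ U, ¬ G.Adj a z ∧ a ≠ z := fun z hz =>
    ⟨fun h => hU z hz (hF.adj _ _ h), fun h => hU z hz (h ▸ hF.refl a)⟩
  refine hF.bypass a x y ⟨hF.symm _ _ hx, hy, d, ?_, hdy⟩
  have hcd : InComp F U c d := (hc.symm hF.symm hb).trans hd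
  refine .head (b := c) ⟨hF.symm _ _ hcx, havoid c (hc.mem hb)⟩ ?_
  exact hcd.lift id fun p q h => ⟨h.1, havoid q h.2⟩

/-- **Dirac's lemma**: in a chordal graph, every vertex that is not adjacent to all the others has
a simplicial non-neighbour. -/
theorem BypassClosed.exists_simplicial_not_adj {V : Type} [Finite V] {G : SimpleGraph V}
    {F : V → V → Prop} (hF : BypassClosed G F) (U : Set V) (a : V) (ha : a ∈ U)
    (hna : ∃ b ∈ U, ¬ F a b) :
    ∃ v ∈ U, ¬ F a v ∧ ∀ x ∈ U, ∀ y ∈ U, F v x → F v y → F x y := by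
  induction hn : U.ncard using Nat.strong_induction_on generalizing U a with
  | _ n ih =>
    subst hn
    obtain ⟨b, hb, hab⟩ := hna
    let U₀ : Set V := {z | z ∈ U ∧ ¬ F a z}
    have hU₀ : ∀ z ∈ U₀, ¬ F a z := fun z hz => hz.2
    have hb₀ : b ∈ U₀ := ⟨hb, hab⟩
    let C : Set V := {z | InComp F U₀ b z}
    let S : Set V := {z | z ∈ U ∧ F a z ∧ ∃ c ∈ C, F c z}
    have hCU : ∀ c ∈ C, c ∈ U₀ := fun c hc => InComp.mem hb₀ hc
    have hS : ∀ x ∈ S, ∀ y ∈ S, F x y := by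
      rintro x ⟨-, hx, c, hc, hcx⟩ y ⟨-, hy, d, hd, hdy⟩
      exact hF.clique_nbhd hU₀ hb₀ hc hd hx hy hcx hdy
    have hN : ∀ c ∈ C, ∀ x ∈ U, F c x → x ∈ C ∪ S := by
      intro c hc x hx hcx
      by_cases hax : F a x
      · exact Or.inr ⟨hx, hax, c, hc, hcx⟩
      · exact Or.inl (Relation.ReflTransGen.tail hc ⟨hcx, hx, hax⟩)
    have hsub : C ∪ S ⊆ U := Set.union_subset (fun c hc => (hCU c hc).1) fun s hs => hs.1
    -- it suffices to find a vertex of `C` that is simplicial in `C ∪ S`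
    suffices h : ∃ v ∈ C, ∀ x ∈ C ∪ S, ∀ y ∈ C ∪ S, F v x → F v y → F x y by
      obtain ⟨v, hv, h⟩ := h
      exact ⟨v, (hCU v hv).1, (hCU v hv).2, fun x hx y hy hvx hvy =>
        h x (hN v hv x hx hvx) y (hN v hv y hy hvy) hvx hvy⟩
    have haC : a ∉ C := fun h => (hCU a h).2 (hF.refl a)
    by_cases hs : ∃ s ∈ S, ∃ z ∈ C ∪ S, ¬ F s z
    · obtain ⟨s, hs, hz⟩ := hs
      have haS : a ∉ S := fun ⟨_, _, c, hc, hca⟩ => (hCU c hc).2 (hF.symm _ _ hca)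
      obtain ⟨v, hv, hsv, h⟩ := ih (C ∪ S).ncard
        (Set.ncard_lt_ncard ⟨hsub, fun h => (h ha).elim haC haS⟩) (C ∪ S) s (Or.inr hs) hz rfl
      exact ⟨v, hv.resolve_right fun h => hsv (hS s hs v h), h⟩
    · push Not at hs
      have hsimp : ∃ v ∈ C, ∀ x ∈ C, ∀ y ∈ C, F v x → F v y → F x y := by
        by_cases hC : ∃ c ∈ C, ∃ d ∈ C, ¬ F c d
        · obtain ⟨c, hc, hd⟩ := hC
          obtain ⟨v, hv, -, h⟩ := ih C.ncard
            (Set.ncard_lt_ncard ⟨fun c hc => (hCU c hc).1, fun h => haC (h ha)⟩) C c hc hd rfl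
          exact ⟨v, hv, h⟩
        · push Not at hC
          exact ⟨b, .refl, fun x hx y hy _ _ => hC x hx y hy⟩
      obtain ⟨v, hv, h⟩ := hsimp
      refine ⟨v, hv, ?_⟩
      rintro x (hx | hx) y hy hvx hvy
      · rcases hy with hy | hy
        · exact h x hx y hy hvx hvy
        · exact hF.symm _ _ (hs y hy x (Or.inl hx))
      · exact hs x hx y hy

theorem BypassClosed.exists_simplicial {V : Type} [Finite V] {G : SimpleGraph V}
    {F : V → V → Prop} (hF : BypassClosed G F) (U : Set V) (hU : U.Nonempty) :
    ∃ v ∈ U, ∀ x ∈ U, ∀ y ∈ U, F v x → F v y → F x y := by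
  by_cases hC : ∃ c ∈ U, ∃ d ∈ U, ¬ F c d
  · obtain ⟨c, hc, hd⟩ := hC
    obtain ⟨v, hv, -, h⟩ := hF.exists_simplicial_not_adj U c hc hd
    exact ⟨v, hv, h⟩
  · push Not at hC
    obtain ⟨b, hb⟩ := hU
    exact ⟨b, hb, fun x hx y hy _ _ => hC x hx y hy⟩

/-- In a component `U` in which both `x` and `y` have neighbours, some walk from `y` reaches a
neighbour of `x` and has no earlier vertex in the closed neighbourhood of `x`. -/
theorem BypassClosed.exists_avoiding_walk {V : Type} {G : SimpleGraph V} {F : V → V → Prop}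
    (hF : BypassClosed G F) {U : Set V} {b x y c d : V} (hb : b ∈ U)
    (hc : InComp F U b c) (hd : InComp F U b d) (hxc : F x c) (hyd : F y d) :
    ∃ p q, Relation.ReflTransGen (AvoidStep G F x) y p ∧ F p q ∧ F x q ∧ InComp F U b q := by
  have hdc : InComp F U d c := (hd.symm hF.symm hb).trans hc
  have key : ∀ z, InComp F U d z →
      (∃ p q, Relation.ReflTransGen (AvoidStep G F x) y p ∧ F p q ∧ F x q ∧ InComp F U b q) ∨
      (Relation.ReflTransGen (AvoidStep G F x) y z ∧ ¬ F x z) := by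
    have hav : ∀ {p z}, F p z → ¬ F x z → AvoidStep G F x p z := fun hpz hz =>
      ⟨hpz, fun h => hz (hF.adj _ _ h), fun h => hz (h ▸ hF.refl x)⟩
    intro z hz
    induction hz with
    | refl =>
      by_cases hxd : F x d
      · exact Or.inl ⟨y, d, .refl, hyd, hxd, hd⟩
      · exact Or.inr ⟨.single (hav hyd hxd), hxd⟩
    | @tail p z h1 h2 ih =>
      rcases ih with ih | ⟨h3, -⟩
      · exact Or.inl ih
      by_cases hxz : F x z
      · exact Or.inl ⟨p, z, h3, h2.1, hxz, hd.trans (h1.tail h2)⟩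
      · exact Or.inr ⟨h3.tail (hav h2.1 hxz), hxz⟩
  exact (key c hdc).resolve_right fun h => h.2 hxc

/-- A pair outside a bypass-closed relation is separated by a clique of `G`: the minimal separator
of the pair close to one end is a clique of the chordal graph `F`, and a pair of its vertices not
adjacent in `G` would yield a bypass from one side to the other. -/
theorem BypassClosed.cliqueSeparated {V : Type} {G : SimpleGraph V} {F : V → V → Prop}
    (hF : BypassClosed G F) {u v : V} (huv : ¬ F u v) : CliqueSeparated G Set.univ u v := by
  let U₀ : Set V := {z | ¬ F u z}
  have hv₀ : v ∈ U₀ := huv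
  -- the component of `v` outside the neighbourhood of `u`, and its neighbourhood
  let C : Set V := {z | InComp F U₀ v z}
  let S₀ : Set V := {z | F u z ∧ ∃ c ∈ C, F c z}
  let U₁ : Set V := S₀ᶜ
  have hu₁ : u ∈ U₁ := fun ⟨_, c, hc, hcu⟩ => InComp.mem hv₀ hc (hF.symm _ _ hcu)
  -- the component of `u` outside `S₀`, and its neighbourhood
  let P : Set V := {z | InComp F U₁ u z}
  let S : Set V := {z | z ∈ S₀ ∧ ∃ c ∈ P, F c z}
  have hP₁ : ∀ p ∈ P, p ∉ S₀ := fun p hp => InComp.mem hu₁ hp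
  have hPC : ∀ p ∈ P, p ∉ C := by
    intro p hp
    change InComp F U₁ u p at hp
    induction hp with
    | refl => exact fun h => InComp.mem hv₀ h (hF.refl u)
    | @tail p q h1 h2 ih =>
      intro hq
      have ih := ih
      have hqp := hF.symm _ _ h2.1
      by_cases hup : F u p
      · exact hP₁ p h1 ⟨hup, q, hq, hqp⟩
      · exact ih (Relation.ReflTransGen.tail hq ⟨hqp, hup⟩)
  have hPE : ∀ p ∈ P, ∀ r, F p r → r ∈ P ∪ S := by
    intro p hp r hpr
    by_cases hr : r ∈ S₀
    · exact Or.inr ⟨hr, p, hp, hpr⟩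
    · exact Or.inl (Relation.ReflTransGen.tail hp ⟨hpr, hr⟩)
  have hvC : v ∈ C := .refl
  refine ⟨P, S, ?_, Set.subset_univ _, Set.disjoint_left.2 fun p hp h => hP₁ p hp h.1, .refl,
    trivial, fun h => hPC v h hvC, fun h => huv h.1.1, ?_⟩
  · rintro x ⟨⟨hux, c, hc, hcx⟩, p, hp, hpx⟩ y ⟨⟨huy, d, hd, hdy⟩, q, hq, hqy⟩ hxy
    by_contra hadj
    have hFxy : F x y := hF.clique_nbhd (fun z hz => hz) hv₀ hc hd hux huy hcx hdy
    obtain ⟨p₁, q₁, hw₁, hpq₁, hxq₁, hq₁⟩ := hF.exists_avoiding_walk hu₁ hp hq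
      (hF.symm _ _ hpx) (hF.symm _ _ hqy)
    obtain ⟨p₂, q₂, hw₂, hpq₂, hxq₂, hq₂⟩ := hF.exists_avoiding_walk hv₀ hc hd
      (hF.symm _ _ hcx) (hF.symm _ _ hdy)
    -- the bypass runs from `q₁` on the side of `u` back to `y` and on to `q₂` on the side of `v`
    have hback : Relation.ReflTransGen (AvoidStep G F x) q₁ y := by
      have hy : ¬ G.Adj x y ∧ x ≠ y := ⟨hadj, hxy⟩
      have hrev : ∀ z, Relation.ReflTransGen (AvoidStep G F x) y z →
          ∀ r, F z r → Relation.ReflTransGen (AvoidStep G F x) r y := by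
        intro z hz
        induction hz with
        | refl => exact fun r hr => .single ⟨hF.symm _ _ hr, hy⟩
        | tail h1 h2 ih =>
          exact fun r hr => .head ⟨hF.symm _ _ hr, h2.2⟩ (ih _ h2.1)
      exact hrev p₁ hw₁ q₁ hpq₁
    have := hF.bypass x q₁ q₂ ⟨hF.symm _ _ hxq₁, hxq₂, p₂, hback.trans hw₂, hpq₂⟩
    rcases hPE q₁ hq₁ q₂ this with h | h
    · exact hPC q₂ h hq₂
    · exact InComp.mem hv₀ hq₂ h.1.1
  · intro p hp r _ hrP hrS hadj
    exact (hPE p hp r (hF.adj _ _ hadj)).elim hrP hrS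

/-! ### Computing the tested sets by iteration -/

/-- Iterating an inflationary operator on binary relations over `n` points reaches a fixed point
within `n * n` rounds. -/
theorem iterate_inflationary_fixed {n : ℕ} (g : (Fin n → Fin n → Prop) → Fin n → Fin n → Prop)
    (hg : ∀ R u v, R u v → g R u v) (R : Fin n → Fin n → Prop) :
    g (g^[n * n] R) = g^[n * n] R := by
  let s : (Fin n → Fin n → Prop) → Set (Fin n × Fin n) := fun R => {p | R p.1 p.2}
  have hs : ∀ R, s R ⊆ s (g R) := fun R p hp => hg R _ _ hp
  have key : ∀ i, g (g^[i] R) = g^[i] R ∨ i ≤ (s (g^[i] R)).ncard := by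
    intro i
    induction i with
    | zero => exact Or.inr (Nat.zero_le _)
    | succ i ih =>
      rw [Function.iterate_succ_apply']
      rcases ih with ih | ih
      · left
        rw [ih, ih]
      · by_cases h : g (g^[i] R) = g^[i] R
        · left
          rw [h, h]
        · right
          refine Nat.succ_le_of_lt (ih.trans_lt (Set.ncard_lt_ncard ⟨hs _, fun hsub => h ?_⟩))
          funext u v
          exact propext ⟨fun huv => hsub (show (u, v) ∈ s _ from huv), hg _ _ _⟩
  rcases key (n * n) with h | h
  · exact h
  · have huniv : s (g^[n * n] R) = Set.univ := by
      refine Set.eq_of_subset_of_ncard_le (Set.subset_univ _) ?_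
      simpa [Set.ncard_univ] using h
    funext u v
    have huv : (u, v) ∈ s (g^[n * n] R) := huniv ▸ Set.mem_univ _
    exact propext ⟨fun _ => huv, hg _ _ _⟩

/-- One round of extending walks by a step outside the closed neighbourhood of `w`. -/
def reachStep {V : Type} (G : SimpleGraph V) (F : V → V → Prop) (w : V) (R : V → V → Prop) :
    V → V → Prop :=
  fun u y => R u y ∨ ∃ x, R u x ∧ F x y ∧ ¬ G.Adj w y ∧ w ≠ y

/-- Adds to `F` the pairs that are ends of a bypass around `w`, where `R` is the relation of being
joined by a walk outside the closed neighbourhood of `w`. -/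
def addBypass {V : Type} (F R : V → V → Prop) (w : V) : V → V → Prop :=
  fun u v => F u v ∨ (F u w ∧ F w v ∧ ∃ x, R u x ∧ F x v) ∨ (F v w ∧ F w u ∧ ∃ x, R v x ∧ F x u)

theorem iterate_reachStep {n : ℕ} (G : SimpleGraph (Fin n)) (F : Fin n → Fin n → Prop)
    (w u v : Fin n) :
    (reachStep G F w)^[n * n] Eq u v ↔ Relation.ReflTransGen (AvoidStep G F w) u v := by
  constructor
  · have key : ∀ i u v, (reachStep G F w)^[i] Eq u v →
        Relation.ReflTransGen (AvoidStep G F w) u v := by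
      intro i
      induction i with
      | zero =>
        rintro u v h
        rw [show u = v from h]
      | succ i ih =>
        intro u v h
        rw [Function.iterate_succ_apply'] at h
        rcases h with h | ⟨x, h, hx⟩
        · exact ih u v h
        · exact (ih u x h).tail hx
    exact key _ u v
  · have hinf : ∀ (R : Fin n → Fin n → Prop) u v, R u v → reachStep G F w R u v :=
      fun _ _ _ h => Or.inl h
    have hstart : ∀ i, (reachStep G F w)^[i] Eq u u := by
      intro i
      induction i with
      | zero => exact rfl
      | succ i ih =>
        rw [Function.iterate_succ_apply']
        exact Or.inl ih
    intro h
    induction h with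
    | refl => exact hstart _
    | tail _ h2 ih =>
      rw [← iterate_inflationary_fixed _ hinf]
      exact Or.inr ⟨_, ih, h2⟩

/-- Adds the ends of all bypasses around `w`. -/
def bypassStep {n : ℕ} (G : SimpleGraph (Fin n)) (F : Fin n → Fin n → Prop) (w : Fin n) :
    Fin n → Fin n → Prop :=
  addBypass F ((reachStep G F w)^[n * n] Eq) w

theorem bypassStep_iff {n : ℕ} {G : SimpleGraph (Fin n)} {F : Fin n → Fin n → Prop}
    {w u v : Fin n} :
    bypassStep G F w u v ↔ F u v ∨ Bypass G F w u v ∨ Bypass G F w v u := by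
  simp only [bypassStep, addBypass, iterate_reachStep, Bypass]

/-- Handles all possible middle vertices of a bypass one after the other. -/
def bypassRound {n : ℕ} (G : SimpleGraph (Fin n)) (F : Fin n → Fin n → Prop) :
    Fin n → Fin n → Prop :=
  (List.finRange n).foldl (bypassStep G) F

/-- The bypass-closed relation generated by adjacency in `G`. -/
def bypassClosure {n : ℕ} (G : SimpleGraph (Fin n)) : Fin n → Fin n → Prop :=
  (bypassRound G)^[n * n] fun u v => G.Adj u v ∨ u = v

theorem foldl_bypassStep_of {n : ℕ} {G : SimpleGraph (Fin n)} (l : List (Fin n))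
    (F : Fin n → Fin n → Prop) {u v : Fin n} (h : F u v) : l.foldl (bypassStep G) F u v := by
  induction l generalizing F with
  | nil => exact h
  | cons a l ih => exact ih _ (bypassStep_iff.2 (Or.inl h))

/-- An invariant of the single steps is an invariant of the whole computation. -/
theorem bypassClosure_induction {n : ℕ} {G : SimpleGraph (Fin n)}
    {p : (Fin n → Fin n → Prop) → Prop} (h0 : p fun u v => G.Adj u v ∨ u = v)
    (h1 : ∀ F w, p F → p (bypassStep G F w)) : p (bypassClosure G) := by
  have hround : ∀ (l : List (Fin n)) F, p F → p (l.foldl (bypassStep G) F) := by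
    intro l
    induction l with
    | nil => exact fun F h => h
    | cons a l ih => exact fun F h => ih _ (h1 F a h)
  have hiter : ∀ i, p ((bypassRound G)^[i] fun u v => G.Adj u v ∨ u = v) := by
    intro i
    induction i with
    | zero => exact h0
    | succ i ih =>
      rw [Function.iterate_succ_apply']
      exact hround _ _ ih
  exact hiter _

theorem bypassClosure_not_cliqueSeparated {n : ℕ} {G : SimpleGraph (Fin n)} {u v : Fin n}
    (h : bypassClosure G u v) : ¬ CliqueSeparated G Set.univ u v := by
  refine bypassClosure_induction
    (p := fun F => ∀ u v, F u v → ¬ CliqueSeparated G Set.univ u v) ?_ ?_ u v h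
  · rintro u v (h | rfl)
    · exact not_cliqueSeparated_of_adj h
    · exact not_cliqueSeparated_self
  · intro F w ih u v h
    rcases bypassStep_iff.1 h with h | h | h
    · exact ih u v h
    · exact h.not_cliqueSeparated ih
    · exact fun hs => h.not_cliqueSeparated ih hs.symm

theorem bypassClosure_closed {n : ℕ} (G : SimpleGraph (Fin n)) :
    BypassClosed G (bypassClosure G) where
  refl u := bypassClosure_induction (p := fun F => F u u) (Or.inr rfl)
    fun F w h => bypassStep_iff.2 (Or.inl h)
  symm u v h := by
    refine bypassClosure_induction (p := fun F => ∀ u v, F u v → F v u) ?_ ?_ u v h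
    · rintro u v (h | h)
      · exact Or.inl h.symm
      · exact Or.inr h.symm
    · intro F w ih u v h
      rcases bypassStep_iff.1 h with h | h | h
      · exact bypassStep_iff.2 (Or.inl (ih u v h))
      · exact bypassStep_iff.2 (Or.inr (Or.inr h))
      · exact bypassStep_iff.2 (Or.inr (Or.inl h))
  adj u v h := bypassClosure_induction (p := fun F => F u v) (Or.inl h)
    fun F w h => bypassStep_iff.2 (Or.inl h)
  bypass := by
    have hfix : bypassRound G (bypassClosure G) = bypassClosure G :=
      iterate_inflationary_fixed _ (fun R u v h => foldl_bypassStep_of _ R h) _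
    -- at a fixed point of a round, every step of the round is void
    have hstep : ∀ (l : List (Fin n)) F, l.foldl (bypassStep G) F = F →
        ∀ w ∈ l, bypassStep G F w = F := by
      intro l
      induction l with
      | nil => simp
      | cons a l ih =>
        intro F hF w hw
        have ha : bypassStep G F a = F := by
          funext u v
          refine propext ⟨fun h => ?_, fun h => bypassStep_iff.2 (Or.inl h)⟩
          rw [← hF]
          exact foldl_bypassStep_of l _ h
        rcases List.mem_cons.1 hw with rfl | hw
        · exact ha
        · rw [List.foldl_cons, ha] at hF
          exact ih F hF w hw
    intro w u v h
    rw [← hstep _ _ hfix w (List.mem_finRange w)]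
    exact bypassStep_iff.2 (Or.inr (Or.inl h))

/-- `u` has not been removed, and its remaining `F`-neighbours form a clique of `F`. A vertex `x`
counts as removed if `D x x`. -/
def IsSimplicial {V : Type} (F D : V → V → Prop) (u : V) : Prop :=
  ¬ D u u ∧ ∀ x y, ¬ D x x → ¬ D y y → F u x → F u y → F x y

/-- One round of elimination: the remaining neighbourhood of each simplicial vertex is recorded as
a row of `S`, and then the simplicial vertices are removed. -/
def elimStep {V : Type} (F : V → V → Prop) (s : (V → V → Prop) × (V → V → Prop)) :
    (V → V → Prop) × (V → V → Prop) :=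
  (fun u x => s.1 u x ∨ IsSimplicial F s.2 u ∧ ¬ s.2 x x ∧ F u x,
    fun u v => s.2 u v ∨ IsSimplicial F s.2 u)

/-- The relation whose rows are the vertex sets to be tested. -/
def testedSets {n : ℕ} (F : Fin n → Fin n → Prop) : Fin n → Fin n → Prop :=
  ((elimStep F)^[n * n] (fun _ _ => False, fun _ _ => False)).1

theorem iterate_elimStep_invariant {n : ℕ} {F : Fin n → Fin n → Prop} (i : ℕ) :
    let s := (elimStep F)^[i] (fun _ _ => False, fun _ _ => False)
    (∀ u, ¬ s.2 u u → ∀ x, ¬ s.1 u x) ∧ (∀ u x y, s.1 u x → s.1 u y → F x y) ∧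
      ∀ K : Set (Fin n), (∀ x ∈ K, ∀ y ∈ K, F x y) → (∃ x ∈ K, s.2 x x) →
        ∃ u, ∀ x ∈ K, s.1 u x := by
  induction i with
  | zero => simp
  | succ i ih =>
    rw [Function.iterate_succ_apply']
    generalize (elimStep F)^[i] (fun _ _ => False, fun _ _ => False) = s at ih ⊢
    obtain ⟨h1, h2, h3⟩ := ih
    refine ⟨?_, ?_, ?_⟩
    · intro u hu x hx
      simp only [elimStep, not_or] at hu hx
      rcases hx with hx | hx
      · exact h1 u hu.1 x hx
      · exact hu.2 hx.1
    · intro u x y hx hy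
      rcases hx with hx | hx
      · rcases hy with hy | hy
        · exact h2 u x y hx hy
        · exact (h1 u hy.1.1 x hx).elim
      · rcases hy with hy | hy
        · exact (h1 u hx.1.1 y hy).elim
        · exact hx.1.2 x y hx.2.1 hy.2.1 hx.2.2 hy.2.2
    · intro K hK hKD
      by_cases hD : ∃ x ∈ K, s.2 x x
      · obtain ⟨u, hu⟩ := h3 K hK hD
        exact ⟨u, fun x hx => Or.inl (hu x hx)⟩
      · push Not at hD
        obtain ⟨u, huK, hu⟩ := hKD
        have hsu := hu.resolve_left (hD u huK)
        exact ⟨u, fun x hx => Or.inr ⟨hsu, hD x hx, hK u huK x hx⟩⟩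

theorem testedSets_clique {n : ℕ} {F : Fin n → Fin n → Prop} {u x y : Fin n}
    (hx : testedSets F u x) (hy : testedSets F u y) : F x y :=
  (iterate_elimStep_invariant (n * n)).2.1 u x y hx hy

/-- Each nonempty clique of a bypass-closed relation lies in a tested set, since by Dirac's lemma
all vertices are eliminated. -/
theorem exists_subset_testedSets {n : ℕ} {G : SimpleGraph (Fin n)} {F : Fin n → Fin n → Prop}
    (hF : BypassClosed G F) (K : Set (Fin n)) (hK : ∀ x ∈ K, ∀ y ∈ K, F x y) (hne : K.Nonempty) :
    ∃ u, ∀ x ∈ K, testedSets F u x := by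
  refine (iterate_elimStep_invariant (n * n)).2.2 K hK ?_
  obtain ⟨k, hk⟩ := hne
  refine ⟨k, hk, ?_⟩
  have hsnd : ∀ i s, ((elimStep F)^[i] s).2 =
      (fun (D : Fin n → Fin n → Prop) u v => D u v ∨ IsSimplicial F D u)^[i] s.2 := by
    intro i
    induction i with
    | zero => exact fun s => rfl
    | succ i ih => exact fun s => ih _
  have hfix := iterate_inflationary_fixed
    (fun (D : Fin n → Fin n → Prop) u v => D u v ∨ IsSimplicial F D u) (fun _ _ _ h => Or.inl h)
    (fun _ _ => False)
  rw [← hsnd _ (fun _ _ => False, fun _ _ => False)] at hfix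
  generalize ((elimStep F)^[n * n] (fun _ _ => False, fun _ _ => False)).2 = D at hfix ⊢
  by_contra hk
  obtain ⟨v, hv, hsimp⟩ := hF.exists_simplicial {x | ¬ D x x} ⟨k, hk⟩
  have : D v v := by
    rw [← hfix]
    exact Or.inr ⟨hv, fun x y hx hy hvx hvy => hsimp x hx y hy hvx hvy⟩
  exact hv this

/-- The vertex sets on which the given machine is run. -/
def testedSet {n : ℕ} (G : SimpleGraph (Fin n)) (u : Fin n) : Set (Fin n) :=
  {x | testedSets (bypassClosure G) u x}

theorem induce_testedSet_mem {X : GraphClass} (hX : X.Hereditary) {n : ℕ}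
    {G : SimpleGraph (Fin n)} (hG : CClosure X (Fin n) G) (u : Fin n) :
    X (testedSet G u) (G.induce (testedSet G u)) := by
  obtain ⟨T, hT, hatom⟩ := exists_isCliqueAtom_superset G (testedSet G u) Set.univ
    (Set.subset_univ _) fun x hx y hy =>
      bypassClosure_not_cliqueSeparated (testedSets_clique hx hy)
  exact hX _ _ _ _ (CClosure.of_atom hX hG hatom) ⟨G.induceHomOfLE hT⟩

theorem colorable_iff_testedSet {n : ℕ} (G : SimpleGraph (Fin n)) (k : ℕ) :
    G.Colorable k ↔ ∀ u, (G.induce (testedSet G u)).Colorable k := by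
  constructor
  · exact fun h u => h.of_hom (SimpleGraph.Embedding.induce _).toHom
  · intro h
    have huniv : (G.induce Set.univ).Colorable k := by
      refine colorable_of_atoms G k Set.univ fun T _ hT => ?_
      rw [isCliqueAtom_induce_iff] at hT
      rcases T.eq_empty_or_nonempty with rfl | hne
      · exact SimpleGraph.Colorable.of_isEmpty k
      have hF := bypassClosure_closed G
      obtain ⟨u, hu⟩ := exists_subset_testedSets hF T (fun x hx y hy => by
        by_contra hxy
        obtain ⟨P, Q, hQ, -, hd, hxP, -, hyP, hyQ, hE⟩ := hF.cliqueSeparated hxy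
        exact hT x hx y hy ⟨P ∩ T, Q, hQ, Set.inter_subset_right,
          hd.mono_left Set.inter_subset_left, ⟨hxP, hx⟩, hy, fun h => hyP h.1, hyQ,
          fun p hp r hr hrP hrQ => hE p hp.1 r trivial (fun h => hrP ⟨h, hr⟩) hrQ⟩) hne
      exact (h u).of_hom (G.induceHomOfLE (show T ⊆ testedSet G u from hu)).toHom
    exact huniv.of_hom (SimpleGraph.induceUnivIso G).symm.toHom

/-! ### Fragments of stack machines -/

/-- Changes the labels in the jumps of a statement. -/
def relabel {K : Type} {Γ : K → Type} {Λ Λ' σ : Type} (e : Λ → Λ') :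
    Turing.TM2.Stmt Γ Λ σ → Turing.TM2.Stmt Γ Λ' σ
  | .push k f q => .push k f (relabel e q)
  | .peek k f q => .peek k f (relabel e q)
  | .pop k f q => .pop k f (relabel e q)
  | .load f q => .load f (relabel e q)
  | .branch f q₁ q₂ => .branch f (relabel e q₁) (relabel e q₂)
  | .goto f => .goto fun v => e (f v)
  | .halt => .halt

theorem relabel_relabel {K : Type} {Γ : K → Type} {Λ Λ' Λ'' σ : Type} (e : Λ → Λ') (e' : Λ' → Λ'')
    (q : Turing.TM2.Stmt Γ Λ σ) : relabel e' (relabel e q) = relabel (fun l => e' (e l)) q := by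
  induction q <;> simp_all [relabel]

theorem relabel_id {K : Type} {Γ : K → Type} {Λ σ : Type} (q : Turing.TM2.Stmt Γ Λ σ) :
    relabel (fun l => l) q = q := by
  induction q <;> simp_all [relabel]

/-- A piece of code for a stack machine, with one entry and one exit. The label `none` stands for
the exit. The machine state has a register for a letter that was popped. -/
structure Frag {K : Type} (Γ : K → Type) (σ : Type) where
  Λ : Type
  [fintype : Fintype Λ]
  entry : Λ
  code : Λ → Turing.TM2.Stmt Γ (Option Λ) (σ × Option (Option Bool))

attribute [instance] Frag.fintype

namespace Frag

variable {K : Type} [DecidableEq K] {Γ : K → Type} {σ : Type} [Inhabited σ]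

/-- The machine with code `m` goes from `c` to `c'` in exactly `n` steps. -/
def Reach {Λ σ : Type} (m : Λ → Turing.TM2.Stmt Γ Λ σ) (c : Turing.TM2.Cfg Γ Λ σ) (n : ℕ)
    (c' : Turing.TM2.Cfg Γ Λ σ) : Prop :=
  (flip bind (Turing.TM2.step m))^[n] (some c) = some c'

theorem Reach.trans {Λ σ : Type} {m : Λ → Turing.TM2.Stmt Γ Λ σ} {c c' c'' : Turing.TM2.Cfg Γ Λ σ}
    {n n' : ℕ} (h : Reach m c n c') (h' : Reach m c' n' c'') : Reach m c (n + n') c'' := by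
  unfold Reach at *
  rw [add_comm, Function.iterate_add_apply, h, h']

theorem Reach.single {Λ σ : Type} {m : Λ → Turing.TM2.Stmt Γ Λ σ} {c c' : Turing.TM2.Cfg Γ Λ σ}
    (h : Turing.TM2.step m c = some c') : Reach m c 1 c' :=
  h

/-- Placed anywhere in any machine, the fragment leads from stack contents `S` at its entry to stack
contents `S'` at its exit, in at most `t` steps. The state is the default one at both ends, and the
content of the register does not matter. -/
def Runs (F : Frag Γ σ) (S S' : ∀ k, List (Γ k)) (t : ℕ) : Prop :=
  ∀ (Λ' : Type) (m : Λ' → Turing.TM2.Stmt Γ Λ' (σ × Option (Option Bool))) (e : Option F.Λ → Λ'),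
    (∀ l, m (e (some l)) = relabel e (F.code l)) → ∀ r, ∃ r' n, n ≤ t ∧
      Reach m ⟨some (e (some F.entry)), (default, r), S⟩ n ⟨some (e none), (default, r'), S'⟩

theorem Runs.mono {F : Frag Γ σ} {S S' : ∀ k, List (Γ k)} {t t' : ℕ} (h : F.Runs S S' t)
    (ht : t ≤ t') : F.Runs S S' t' := by
  intro Λ' m e he r
  obtain ⟨r', n, hn, h⟩ := h Λ' m e he r
  exact ⟨r', n, hn.trans ht, h⟩

/-- A fragment that consists of one statement. -/
def single (q : Turing.TM2.Stmt Γ (Option Unit) (σ × Option (Option Bool))) : Frag Γ σ where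
  Λ := Unit
  entry := ()
  code _ := q

/-- Does nothing. -/
def skip : Frag Γ σ := single (.goto fun _ => none)

theorem runs_skip (S : ∀ k, List (Γ k)) : (skip : Frag Γ σ).Runs S S 1 := by
  intro Λ' m e he r
  refine ⟨r, 1, le_rfl, Reach.single ?_⟩
  rw [Turing.TM2.step, he]
  rfl

/-- Pushes a fixed letter. -/
def push (k : K) (a : Γ k) : Frag Γ σ := single (.push k (fun _ => a) (.goto fun _ => none))

theorem runs_push (k : K) (a : Γ k) (S : ∀ k, List (Γ k)) :
    (push k a : Frag Γ σ).Runs S (Function.update S k (a :: S k)) 1 := by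
  intro Λ' m e he r
  refine ⟨r, 1, le_rfl, Reach.single ?_⟩
  rw [Turing.TM2.step, he]
  rfl

/-- Sequential composition. -/
def seq (F G : Frag Γ σ) : Frag Γ σ where
  Λ := F.Λ ⊕ G.Λ
  entry := .inl F.entry
  code
    | .inl l => relabel (fun o => some (o.elim (.inr G.entry) .inl)) (F.code l)
    | .inr l => relabel (Option.map .inr) (G.code l)

theorem Runs.seq {F G : Frag Γ σ} {S S' S'' : ∀ k, List (Γ k)} {t t' : ℕ} (hF : F.Runs S S' t)
    (hG : G.Runs S' S'' t') : (F.seq G).Runs S S'' (t + t') := by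
  intro Λ' m e he r
  obtain ⟨r', n, hn, h⟩ := hF Λ' m (fun o => e (some (o.elim (.inr G.entry) .inl)))
    (fun l => (he (.inl l)).trans (relabel_relabel _ _ _)) r
  obtain ⟨r'', n', hn', h'⟩ := hG Λ' m (fun o => e (o.map .inr))
    (fun l => (he (.inr l)).trans (relabel_relabel _ _ _)) r'
  exact ⟨r'', n + n', add_le_add hn hn', h.trans h'⟩

/-- Pops a stack, and continues depending on the letter found, read through `dec`. -/
def popCase (k : K) (dec : Γ k → Option Bool) (c : Option (Option Bool) → Frag Γ σ) :
    Frag Γ σ where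
  Λ := Option (Σ a, (c a).Λ)
  entry := none
  code
    | none => .pop k (fun s a => (s.1, a.map dec))
        (.goto fun s => some (some ⟨s.2, (c s.2).entry⟩))
    | some ⟨a, l⟩ => relabel (Option.map fun l => some ⟨a, l⟩) ((c a).code l)

theorem Runs.popCase {k : K} {dec : Γ k → Option Bool} {c : Option (Option Bool) → Frag Γ σ}
    {S S' : ∀ k, List (Γ k)} {t : ℕ}
    (h : (c ((S k).head?.map dec)).Runs (Function.update S k (S k).tail) S' t) :
    (popCase k dec c).Runs S S' (1 + t) := by
  intro Λ' m e he r
  obtain ⟨r', n, hn, h⟩ := h Λ' m (fun o => e (o.map fun l => some ⟨_, l⟩))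
    (fun l => (he (some ⟨_, l⟩)).trans (relabel_relabel _ _ _)) ((S k).head?.map dec)
  refine ⟨r', 1 + n, by omega, Reach.trans (Reach.single ?_) h⟩
  have := he none
  simp only [Frag.popCase, relabel] at this
  simp [Turing.TM2.step, Frag.popCase, this, Turing.TM2.stepAux]

/-- Pops a stack until it is empty, executing `body` for each letter found. -/
def loop (k : K) (dec : Γ k → Option Bool) (body : Option Bool → Frag Γ σ) : Frag Γ σ where
  Λ := Option (Σ a, (body a).Λ)
  entry := none
  code
    | none => .pop k (fun s a => (s.1, a.map dec))
        (.goto fun s => s.2.map fun a => some ⟨a, (body a).entry⟩)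
    | some ⟨a, l⟩ => relabel (fun o => some (o.map fun l => ⟨a, l⟩)) ((body a).code l)

theorem Runs.loop_nil {k : K} {dec : Γ k → Option Bool} {body : Option Bool → Frag Γ σ}
    {S : ∀ k, List (Γ k)} (hS : S k = []) : (loop k dec body).Runs S S 1 := by
  intro Λ' m e he r
  refine ⟨none, 1, le_rfl, Reach.single ?_⟩
  have := he none
  simp only [loop, relabel] at this
  have hS' : Function.update S k [] = S := by
    rw [← hS, Function.update_eq_self]
  simp [Turing.TM2.step, loop, this, Turing.TM2.stepAux, hS, hS']

theorem Runs.loop_cons {k : K} {dec : Γ k → Option Bool} {body : Option Bool → Frag Γ σ}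
    {S S₁ S₂ : ∀ k, List (Γ k)} {a : Γ k} {l : List (Γ k)} {t₁ t₂ : ℕ} (hS : S k = a :: l)
    (h₁ : (body (dec a)).Runs (Function.update S k l) S₁ t₁)
    (h₂ : (loop k dec body).Runs S₁ S₂ t₂) : (loop k dec body).Runs S S₂ (1 + t₁ + t₂) := by
  intro Λ' m e he r
  obtain ⟨r', n, hn, h₁⟩ := h₁ Λ' m (fun o => e (some (o.map fun l => ⟨_, l⟩)))
    (fun l => (he (some ⟨_, l⟩)).trans (relabel_relabel _ _ _)) (some (dec a))
  obtain ⟨r'', n', hn', h₂⟩ := h₂ Λ' m e he r'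
  refine ⟨r'', 1 + n + n', by omega, (Reach.trans (Reach.single ?_) h₁).trans h₂⟩
  have := he none
  simp only [loop, relabel] at this
  simp [Turing.TM2.step, loop, this, Turing.TM2.stepAux, hS]

end Frag

/-! ### A stack machine as a subroutine -/

/-- The stack alphabets of a machine that has `M` as a subroutine and a set `κ` of further stacks
with alphabet `Option Bool`. -/
@[reducible]
def SubAlph (M : Turing.FinTM2) (κ : Type) : M.K ⊕ κ → Type
  | .inl k => M.Γ k
  | .inr _ => Option Bool

/-- The contents of all stacks, from those of the stacks of `M` and of the further stacks. -/
def joinStk {M : Turing.FinTM2} {κ : Type} (T : ∀ k, List (M.Γ k)) (L : κ → List (Option Bool)) :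
    ∀ k, List (SubAlph M κ k)
  | .inl k => T k
  | .inr k => L k

@[simp]
theorem joinStk_inl {M : Turing.FinTM2} {κ : Type} (T : ∀ k, List (M.Γ k))
    (L : κ → List (Option Bool)) (k : M.K) : joinStk T L (.inl k) = T k :=
  rfl

@[simp]
theorem joinStk_inr {M : Turing.FinTM2} {κ : Type} (T : ∀ k, List (M.Γ k))
    (L : κ → List (Option Bool)) (k : κ) : joinStk T L (.inr k) = L k :=
  rfl

@[simp]
theorem update_joinStk_inl {M : Turing.FinTM2} {κ : Type} [DecidableEq κ] (T : ∀ k, List (M.Γ k))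
    (L : κ → List (Option Bool)) (k : M.K) (l : List (M.Γ k)) :
    Function.update (joinStk T L) (.inl k) l = joinStk (Function.update T k l) L := by
  funext x
  rcases x with x | x
  · by_cases h : x = k
    · subst h
      simp
    · simp [h]
  · simp

@[simp]
theorem update_joinStk_inr {M : Turing.FinTM2} {κ : Type} [DecidableEq κ] (T : ∀ k, List (M.Γ k))
    (L : κ → List (Option Bool)) (k : κ) (l : List (Option Bool)) :
    Function.update (joinStk T L) (.inr k) l = joinStk T (Function.update L k l) := by
  funext x
  rcases x with x | x
  · simp
  · by_cases h : x = k
    · subst h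
      simp
    · simp [h]

/-- A statement of `M` as a statement of a machine that has `M` as a subroutine. Halting becomes a
jump to the exit. -/
def callStmt (M : Turing.FinTM2) (κ : Type) : Turing.TM2.Stmt M.Γ M.Λ M.σ →
    Turing.TM2.Stmt (SubAlph M κ) (Option M.Λ) (M.σ × Option (Option Bool))
  | .push k f q => .push (.inl k) (fun v => f v.1) (callStmt M κ q)
  | .peek k f q => .peek (.inl k) (fun v a => (f v.1 a, v.2)) (callStmt M κ q)
  | .pop k f q => .pop (.inl k) (fun v a => (f v.1 a, v.2)) (callStmt M κ q)
  | .load f q => .load (fun v => (f v.1, v.2)) (callStmt M κ q)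
  | .branch f q₁ q₂ => .branch (fun v => f v.1) (callStmt M κ q₁) (callStmt M κ q₂)
  | .goto f => .goto fun v => some (f v.1)
  | .halt => .goto fun _ => none

theorem stepAux_callStmt {M : Turing.FinTM2} {κ : Type} [DecidableEq κ] {Λ' : Type}
    (e : Option M.Λ → Λ') (q : Turing.TM2.Stmt M.Γ M.Λ M.σ) (v : M.σ) (r : Option (Option Bool))
    (T : ∀ k, List (M.Γ k)) (L : κ → List (Option Bool)) :
    Turing.TM2.stepAux (relabel e (callStmt M κ q)) (v, r) (joinStk T L) =
      ⟨some (e (Turing.TM2.stepAux q v T).l), ((Turing.TM2.stepAux q v T).var, r),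
        joinStk (Turing.TM2.stepAux q v T).stk L⟩ := by
  induction q generalizing v T with
  | branch f q₁ q₂ ih₁ ih₂ =>
    simp only [callStmt, relabel, Turing.TM2.stepAux]
    cases f v
    · exact ih₂ v T
    · exact ih₁ v T
  | goto f => rfl
  | halt => rfl
  | load f q ih => exact ih _ _
  | push k f q ih =>
    simp only [callStmt, relabel, Turing.TM2.stepAux, update_joinStk_inl, joinStk_inl]
    exact ih _ _
  | peek k f q ih => exact ih _ _
  | pop k f q ih =>
    simp only [callStmt, relabel, Turing.TM2.stepAux, update_joinStk_inl, joinStk_inl]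
    exact ih _ _

/-- The whole of `M` as a fragment. -/
def callFrag (M : Turing.FinTM2) (κ : Type) : Frag (SubAlph M κ) M.σ :=
  letI := M.ΛFin
  { Λ := M.Λ
    entry := M.main
    code := fun l => callStmt M κ (M.m l) }

/-- A run of `M` on its own is a run of `M` as a subroutine. -/
theorem runs_callFrag {M : Turing.FinTM2} {κ : Type} [DecidableEq κ] {T T' : ∀ k, List (M.Γ k)}
    {t : ℕ} (h : StateTransition.EvalsToInTime M.step ⟨some M.main, M.initialState, T⟩
      (some ⟨none, M.initialState, T'⟩) t) (L : κ → List (Option Bool)) :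
    (callFrag M κ).Runs (joinStk T L) (joinStk T' L) t := by
  intro Λ' m e he r
  refine ⟨r, h.steps, h.steps_le_m, ?_⟩
  have key : ∀ (n : ℕ) (c c' : M.Cfg), (flip bind M.step)^[n] (some c) = some c' →
      Frag.Reach m ⟨some (e c.l), (c.var, r), joinStk c.stk L⟩ n
        ⟨some (e c'.l), (c'.var, r), joinStk c'.stk L⟩ := by
    intro n
    induction n with
    | zero =>
      intro c c' hc
      cases hc
      rfl
    | succ n ih =>
      intro c c' hc
      rw [Function.iterate_succ_apply] at hc
      obtain ⟨l, v, T⟩ := c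
      have hnone : ∀ n, (flip bind M.step)^[n] none = none := by
        intro n
        induction n with
        | zero => rfl
        | succ n ih => rw [Function.iterate_succ_apply]; exact ih
      cases l with
      | none =>
        have h0 : (flip bind M.step)^[n] none = some c' := hc
        rw [hnone n] at h0
        cases h0
      | some l =>
        have h1 := ih (Turing.TM2.stepAux (M.m l) v T) c' hc
        rw [add_comm]
        refine Frag.Reach.trans (Frag.Reach.single ?_) h1
        have hl : m (e (some l)) = relabel e (callStmt M κ (M.m l)) := he l
        rw [Turing.TM2.step]
        exact congrArg some
          ((congrArg (fun q => Turing.TM2.stepAux q (v, r) (joinStk T L)) hl).trans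
            (stepAux_callStmt e _ v r T L))
  exact key _ _ _ h.evals_in_steps

/-! ### Elementary stack programs -/

/-- Fragments of machines with `M` as a subroutine. -/
abbrev SubFrag (M : Turing.FinTM2) (κ : Type) : Type 1 := Frag (SubAlph M κ) M.σ

namespace SubFrag

variable {M : Turing.FinTM2} {κ : Type} [DecidableEq κ]

/-- While the stacks of `M` are empty, the fragment turns contents `L` of the other stacks into `L'`
in at most `t` steps, and leaves the stacks of `M` empty. -/
def Local (F : SubFrag M κ) (L L' : κ → List (Option Bool)) (t : ℕ) : Prop :=
  F.Runs (joinStk (fun _ => []) L) (joinStk (fun _ => []) L') t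

theorem Local.mono {F : SubFrag M κ} {L L' : κ → List (Option Bool)} {t t' : ℕ}
    (h : Local F L L' t) (ht : t ≤ t') : Local F L L' t' :=
  Frag.Runs.mono h ht

theorem Local.of_eq {F : SubFrag M κ} {L L' L'' : κ → List (Option Bool)} {t t' : ℕ}
    (h : Local F L L' t) (hL : L' = L'') (ht : t ≤ t') : Local F L L'' t' :=
  hL ▸ h.mono ht

theorem Local.seq {F G : SubFrag M κ} {L L' L'' : κ → List (Option Bool)} {t t' : ℕ}
    (hF : Local F L L' t) (hG : Local G L' L'' t') : Local (Frag.seq F G) L L'' (t + t') :=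
  Frag.Runs.seq hF hG

theorem local_skip (L : κ → List (Option Bool)) : Local (Frag.skip : SubFrag M κ) L L 1 :=
  Frag.runs_skip _

/-- Pushes a letter on a stack outside `M`. -/
def push (k : κ) (a : Option Bool) : SubFrag M κ := Frag.push (.inr k) a

theorem local_push (k : κ) (a : Option Bool) (L : κ → List (Option Bool)) :
    Local (push k a : SubFrag M κ) L (Function.update L k (a :: L k)) 1 := by
  have := Frag.runs_push (σ := M.σ) (Γ := SubAlph M κ) (.inr k) a (joinStk (fun _ => []) L)
  rwa [joinStk_inr, update_joinStk_inr] at this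

/-- Pops a stack outside `M`, and continues depending on the letter found. -/
def pop (k : κ) (c : Option (Option Bool) → SubFrag M κ) : SubFrag M κ :=
  Frag.popCase (.inr k) id c

theorem Local.pop {k : κ} {c : Option (Option Bool) → SubFrag M κ} {L L' : κ → List (Option Bool)}
    {t : ℕ} (h : Local (c (L k).head?) (Function.update L k (L k).tail) L' t) :
    Local (SubFrag.pop k c) L L' (1 + t) := by
  refine Frag.Runs.popCase ?_
  rw [joinStk_inr, update_joinStk_inr, Option.map_id]
  exact h

/-- Empties a stack outside `M`, executing `body` for each letter found. -/
def loop (k : κ) (body : Option Bool → SubFrag M κ) : SubFrag M κ :=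
  Frag.loop (.inr k) id body

theorem Local.loop_nil {k : κ} {body : Option Bool → SubFrag M κ} {L : κ → List (Option Bool)}
    (hL : L k = []) : Local (loop k body) L L 1 :=
  Frag.Runs.loop_nil hL

theorem Local.loop_cons {k : κ} {body : Option Bool → SubFrag M κ}
    {L L₁ L₂ : κ → List (Option Bool)} {a : Option Bool} {l : List (Option Bool)} {t₁ t₂ : ℕ}
    (hL : L k = a :: l) (h₁ : Local (body a) (Function.update L k l) L₁ t₁)
    (h₂ : Local (loop k body) L₁ L₂ t₂) : Local (loop k body) L L₂ (1 + t₁ + t₂) := by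
  have hL' : joinStk (M := M) (fun _ => []) L (.inr k) = a :: l := hL
  refine Frag.Runs.loop_cons hL' ?_ h₂
  rw [update_joinStk_inr]
  exact h₁

/-- Empties a stack. -/
def clear (k : κ) : SubFrag M κ := loop k fun _ => Frag.skip

theorem local_clear (k : κ) (L : κ → List (Option Bool)) :
    Local (clear k : SubFrag M κ) L (Function.update L k []) (2 * (L k).length + 1) := by
  induction hl : L k generalizing L with
  | nil =>
    have : Function.update L k [] = L := by rw [← hl, Function.update_eq_self]
    rw [this]
    exact Local.loop_nil hl
  | cons a l ih =>
    have h := ih (Function.update L k l) (by simp)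
    rw [Function.update_idem] at h
    refine (Local.loop_cons hl (local_skip _) h).mono ?_
    simp only [List.length_cons]
    omega

/-- Moves the content of stack `a` to stack `b`, reversing it. -/
def move (a b : κ) : SubFrag M κ := loop a fun s => push b s

theorem local_move {a b : κ} (hab : a ≠ b) (L : κ → List (Option Bool)) :
    Local (move a b : SubFrag M κ) L
      (Function.update (Function.update L b ((L a).reverse ++ L b)) a [])
      (2 * (L a).length + 1) := by
  induction hl : L a generalizing L with
  | nil =>
    refine (Local.loop_nil hl).of_eq ?_ (by simp)
    rw [← hl]
    simp [hl]
  | cons s l ih =>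
    have h1 := local_push (M := M) b s (Function.update L a l)
    refine (Local.loop_cons hl h1 (ih _ ?_)).of_eq ?_ ?_
    · simp [hab]
    · funext k
      simp only [Function.update_apply]
      split_ifs <;> simp_all
    · simp only [List.length_cons]
      omega

/-- Copies the reversed content of stack `a` onto stack `c`. The content of `a` is kept on stack `t`
in the meantime. -/
def copyRev (a c t : κ) : SubFrag M κ :=
  Frag.seq (loop a fun s => Frag.seq (push t s) (push c s)) (move t a)

theorem local_copyRev {a c t : κ} (hac : a ≠ c) (hat : a ≠ t) (hct : c ≠ t)
    (L : κ → List (Option Bool)) (ht : L t = []) :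
    Local (copyRev a c t : SubFrag M κ) L (Function.update L c ((L a).reverse ++ L c))
      (5 * (L a).length + 2) := by
  have key : ∀ (l : List (Option Bool)) (L : κ → List (Option Bool)), L a = l →
      Local (loop a fun s => Frag.seq (push t s) (push c s) : SubFrag M κ) L
        (Function.update (Function.update (Function.update L a []) t (l.reverse ++ L t)) c
          (l.reverse ++ L c)) (3 * l.length + 1) := by
    intro l
    induction l with
    | nil =>
      intro L hL
      refine (Local.loop_nil hL).of_eq ?_ (by simp)
      funext k
      simp only [Function.update_apply]
      split_ifs <;> simp_all
    | cons s l ih =>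
      intro L hL
      have h1 := (local_push (M := M) t s (Function.update L a l)).seq (local_push c s _)
      refine (Local.loop_cons hL h1 (ih _ ?_)).of_eq ?_ ?_
      · simp [hac, hat]
      · funext k
        simp only [Function.update_apply]
        split_ifs <;> simp_all
      · simp only [List.length_cons]
        omega
  refine ((key _ L rfl).seq (local_move hat.symm _)).of_eq ?_ ?_
  · funext k
    simp only [Function.update_apply]
    split_ifs <;> simp_all
  · simp [ht, hct.symm]
    omega

/-- Pushes on stack `c` as many unit marks as the product of the lengths of the stacks `x` and `y`
of unit marks. -/
def mulAdd (x y c t t' : κ) : SubFrag M κ :=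
  Frag.seq (loop x fun s => Frag.seq (push t' s) (copyRev y c t)) (move t' x)

theorem local_mulAdd {x y c t t' : κ} (hxy : x ≠ y) (hxc : x ≠ c) (hxt : x ≠ t) (hxt' : x ≠ t')
    (hyc : y ≠ c) (hyt : y ≠ t) (hyt' : y ≠ t') (hct : c ≠ t) (hct' : c ≠ t') (htt' : t ≠ t')
    (L : κ → List (Option Bool)) (ht : L t = []) (ht' : L t' = []) {i n : ℕ}
    (hx : L x = List.replicate i none) (hy : L y = List.replicate n none) :
    Local (mulAdd x y c t t' : SubFrag M κ) L
      (Function.update L c (List.replicate (i * n) none ++ L c)) (i * (5 * n + 6) + 2) := by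
  have key : ∀ (i : ℕ) (L : κ → List (Option Bool)), L t = [] → L y = List.replicate n none →
      L x = List.replicate i none →
      Local (loop x fun s => Frag.seq (push t' s) (copyRev y c t) : SubFrag M κ) L
        (Function.update (Function.update (Function.update L x []) t'
          (List.replicate i none ++ L t')) c (List.replicate (i * n) none ++ L c))
        (i * (5 * n + 4) + 1) := by
    intro i
    induction i with
    | zero =>
      intro L ht hy hx
      refine (Local.loop_nil hx).of_eq ?_ (by simp)
      simp only [Nat.zero_mul, List.replicate_zero, List.nil_append]
      funext k
      simp only [Function.update_apply]
      split_ifs <;> simp_all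
    | succ i ih =>
      intro L ht hy hx
      rw [List.replicate_succ] at hx
      have h1 := (local_push (M := M) t' none (Function.update L x (List.replicate i none))).seq
        (local_copyRev hyc hyt hct _ (by simp [htt', hxt.symm, ht]))
      refine (Local.loop_cons hx h1 (ih _ ?_ ?_ ?_)).of_eq ?_ ?_
      · simp [htt', hct.symm, hxt.symm, ht]
      · simp [hyc, hyt', hxy.symm, hy]
      · simp [hxc, hxt']
      · funext k
        simp only [Function.update_apply]
        split_ifs <;> simp_all [Nat.succ_mul, List.replicate_succ']
        rw [← List.append_assoc, ← List.replicate_add]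
      · simp [hyt', hxy.symm, hy]
        ring_nf
        omega
  refine ((key i L ht hy hx).seq (local_move hxt'.symm _)).of_eq ?_ ?_
  · funext k
    simp only [Function.update_apply]
    split_ifs <;> simp_all
  · simp [ht', hct'.symm]
    ring_nf
    omega

/-- Moves entries from the top of stack `b` to stack `s`, as many as there are marks on stack `i`,
and removes these marks. -/
def skipTo (i s b : κ) : SubFrag M κ :=
  loop i fun _ => pop b fun o => o.elim Frag.skip (push s)

theorem local_skipTo {i s b : κ} (his : i ≠ s) (hib : i ≠ b) (hsb : s ≠ b)
    (L : κ → List (Option Bool)) (pre post : List (Option Bool))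
    (hi : L i = List.replicate pre.length none) (hb : L b = pre ++ post) :
    Local (skipTo i s b : SubFrag M κ) L
      (Function.update (Function.update (Function.update L i []) b post) s (pre.reverse ++ L s))
      (3 * pre.length + 1) := by
  induction pre generalizing L with
  | nil =>
    refine (Local.loop_nil hi).of_eq ?_ (by simp)
    funext k
    simp only [Function.update_apply]
    split_ifs <;> simp_all
  | cons a pre ih =>
    rw [List.length_cons, List.replicate_succ] at hi
    have h1 : Local ((pop b fun o => o.elim Frag.skip (push s) : SubFrag M κ))
        (Function.update L i (List.replicate pre.length none))
        (Function.update (Function.update (Function.update L i (List.replicate pre.length none)) b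
          (pre ++ post)) s (a :: L s)) (1 + 1) := by
      refine Local.pop ?_
      rw [Function.update_of_ne hib.symm, hb]
      refine (local_push s a _).of_eq ?_ le_rfl
      simp [hsb, his.symm]
    refine (Local.loop_cons hi h1 (ih _ ?_ ?_)).of_eq ?_ ?_
    · simp [his, hib]
    · simp [hsb.symm]
    · funext k
      simp only [Function.update_apply]
      split_ifs <;> simp_all
    · simp only [List.length_cons]
      omega

/-- Reads an entry of stack `b`, whose position is the number of marks on stack `i`, and continues
depending on whether it is the letter `true`. -/
def readAt (i s b : κ) (c : Bool → SubFrag M κ) : SubFrag M κ :=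
  Frag.seq (skipTo i s b) (pop b fun o =>
    Frag.seq (push b (o.getD none)) (Frag.seq (move s b) (c (decide (o = some (some true))))))

theorem Local.readAt {i s b : κ} (his : i ≠ s) (hib : i ≠ b) (hsb : s ≠ b)
    {L L' : κ → List (Option Bool)} {pre post : List (Option Bool)} {a : Option Bool} {t : ℕ}
    {c : Bool → SubFrag M κ} (hi : L i = List.replicate pre.length none)
    (hb : L b = pre ++ a :: post) (hs : L s = [])
    (h : Local (c (decide (a = some true))) (Function.update L i []) L' t) :
    Local (SubFrag.readAt i s b c) L L' (5 * pre.length + 4 + t) := by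
  have h2 : Local (SubFrag.pop b fun o => Frag.seq (SubFrag.push b (o.getD none))
      (Frag.seq (SubFrag.move s b) (c (decide (o = some (some true))))))
      (Function.update (Function.update (Function.update L i []) b (a :: post)) s
        (pre.reverse ++ L s)) L' (1 + (1 + (2 * pre.length + 1 + t))) := by
    refine Local.pop ?_
    rw [Function.update_of_ne hsb.symm, Function.update_self]
    refine (local_push b _ _).seq (((local_move hsb _).of_eq (t' := 2 * pre.length + 1) ?_ ?_).seq
      (?_ : Local _ (Function.update L i []) L' t))
    · funext k
      simp only [Function.update_apply]
      split_ifs <;> simp_all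
    · simp [hs, hsb]
    · simpa using h
  exact ((local_skipTo his hib hsb L pre (a :: post) hi hb).seq h2).mono (by omega)

/-- Replaces an entry of stack `b`, whose position is the number of marks on stack `i`. -/
def writeAt (i s b : κ) (a : Option Bool) : SubFrag M κ :=
  Frag.seq (skipTo i s b) (pop b fun _ => Frag.seq (push b a) (move s b))

theorem local_writeAt {i s b : κ} (his : i ≠ s) (hib : i ≠ b) (hsb : s ≠ b)
    {L : κ → List (Option Bool)} {pre post : List (Option Bool)} {a a' : Option Bool}
    (hi : L i = List.replicate pre.length none) (hb : L b = pre ++ a :: post) (hs : L s = []) :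
    Local (writeAt i s b a' : SubFrag M κ) L
      (Function.update (Function.update L i []) b (pre ++ a' :: post)) (5 * pre.length + 4) := by
  have h2 : Local (SubFrag.pop b fun _ => Frag.seq (push b a') (move s b) : SubFrag M κ)
      (Function.update (Function.update (Function.update L i []) b (a :: post)) s
        (pre.reverse ++ L s)) _ (1 + (1 + _)) :=
    Local.pop ((local_push b _ _).seq (local_move hsb _))
  refine ((local_skipTo his hib hsb L pre (a :: post) hi hb).seq h2).of_eq ?_ ?_
  · funext k
    simp only [Function.update_apply]
    split_ifs <;> simp_all
  · simp [hs, hsb]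
    omega

/-- Executes `body` as often as there are marks on stack `m`. Stack `v` holds the number of the
current round in unary, stack `c` the number of the remaining rounds. -/
def forVar (m c v t : κ) (body : SubFrag M κ) : SubFrag M κ :=
  Frag.seq (copyRev m c t) (Frag.seq (loop c fun _ => Frag.seq body (push v none)) (clear v))

theorem Local.forVar {m c v t : κ} (hmc : m ≠ c) (hmt : m ≠ t) (hct : c ≠ t) (hcv : c ≠ v)
    {n τ : ℕ} {body : SubFrag M κ} (s : ℕ → κ → List (Option Bool))
    (hm : s 0 m = List.replicate n none) (ht : s 0 t = []) (hv0 : s 0 v = []) (hc0 : s 0 c = [])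
    (hv : s n v = []) (hc : s n c = [])
    (h : ∀ i < n, Local body
      (Function.update (Function.update (s i) v (List.replicate i none)) c
        (List.replicate (n - 1 - i) none))
      (Function.update (Function.update (s (i + 1)) v (List.replicate i none)) c
        (List.replicate (n - 1 - i) none)) τ) :
    Local (SubFrag.forVar m c v t body) (s 0) (s n) (n * (τ + 9) + 4) := by
  have key : ∀ j i, i + j = n → Local (loop c fun _ => Frag.seq body (push v none))
      (Function.update (Function.update (s i) v (List.replicate i none)) c (List.replicate j none))
      (Function.update (Function.update (s n) v (List.replicate n none)) c [])
      (j * (τ + 2) + 1) := by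
    intro j
    induction j with
    | zero =>
      rintro i rfl
      refine (Local.loop_nil (by simp)).of_eq ?_ (by simp)
      simp
    | succ j ih =>
      intro i hi
      have hb := h i (by omega)
      rw [show n - 1 - i = j by omega] at hb
      have h1 := hb.seq (local_push v none _)
      refine (Local.loop_cons (a := none) (l := List.replicate j none)
        (by simp [List.replicate_succ]) ?_ (ih (i + 1) (by omega))).mono (t := 1 + (τ + 1) + _) ?_
      · rw [Function.update_idem]
        refine h1.of_eq ?_ le_rfl
        funext k
        simp only [Function.update_apply]
        split_ifs <;> simp_all [List.replicate_succ]
      · ring_nf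
        omega
  have h1 := (local_copyRev (M := M) hmc hmt hct (s 0) ht)
  have h2 := key n 0 (by omega)
  have h12 : Function.update (s 0) c ((s 0 m).reverse ++ s 0 c) =
      Function.update (Function.update (s 0) v (List.replicate 0 none)) c
        (List.replicate n none) := by
    funext k
    simp only [Function.update_apply]
    split_ifs <;> simp_all
  rw [h12] at h1
  refine (h1.seq (h2.seq (local_clear v _))).of_eq ?_ ?_
  · funext k
    simp only [Function.update_apply]
    split_ifs <;> simp_all
  · simp [hm, hcv.symm]
    ring_nf
    omega

end SubFrag

/-! ### Loop programs on Boolean matrices -/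

/-- Programs that work on `n × n` matrices with names in `μ`, a stack of flags and an output. A
program in `Prog μ d` may use `d` loop variables; a loop binds the variable `d` and lets it run
through all indices of the matrices. -/
inductive Prog (μ : Type) : ℕ → Type
  | skip {d : ℕ} : Prog μ d
  | seq {d : ℕ} (p q : Prog μ d) : Prog μ d
  | set {d : ℕ} (B : μ) (x y : Fin d) (b : Bool) : Prog μ d
  | ite {d : ℕ} (B : μ) (x y : Fin d) (p q : Prog μ d) : Prog μ d
  | loop {d : ℕ} (p : Prog μ (d + 1)) : Prog μ d
  | pushFlag {d : ℕ} (b : Bool) : Prog μ d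
  | popFlag {d : ℕ} (p q : Prog μ d) : Prog μ d
  | emit {d : ℕ} (a : Option Bool) : Prog μ d

/-- What a loop program works on. -/
structure ProgState (μ : Type) (n : ℕ) where
  mat : μ → Fin n → Fin n → Prop
  flags : List Bool
  out : List (Option Bool)

namespace Prog

/-- The number of loops that are nested. -/
def depth {μ : Type} : {d : ℕ} → Prog μ d → ℕ
  | _, skip => 0
  | _, seq p q => max p.depth q.depth
  | _, set _ _ _ _ => 0
  | _, ite _ _ _ p q => max p.depth q.depth
  | _, loop p => p.depth + 1
  | _, pushFlag _ => 0
  | _, popFlag p q => max p.depth q.depth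
  | _, emit _ => 0

open Classical in
/-- The effect of a program. -/
noncomputable def run {μ : Type} [DecidableEq μ] {n : ℕ} :
    {d : ℕ} → Prog μ d → (Fin d → Fin n) → ProgState μ n → ProgState μ n
  | _, skip, _, s => s
  | _, seq p q, env, s => q.run env (p.run env s)
  | _, set B x y b, env, s =>
    { s with mat := Function.update s.mat B fun i j =>
        if i = env x ∧ j = env y then b = true else s.mat B i j }
  | _, ite B x y p q, env, s => if s.mat B (env x) (env y) then p.run env s else q.run env s
  | _, loop p, env, s =>
    (List.finRange n).foldl (fun s i => p.run (Fin.snoc (α := fun _ => Fin n) env i) s) s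
  | _, pushFlag b, _, s => { s with flags := b :: s.flags }
  | _, popFlag p q, env, s =>
    if s.flags.headD false then p.run env { s with flags := s.flags.tail }
    else q.run env { s with flags := s.flags.tail }
  | _, emit a, _, s => { s with out := s.out ++ [a] }

end Prog

/-- The stacks that hold the data of a loop program with matrices named by `μ` and at most `D`
variables: matrices in row-major order, for each variable its value in unary and the number of
remaining rounds of its loop, the size of the matrices, scratch stacks, flags, the output in reverse
order, the number of colors, and a record of negative answers. -/
inductive Key (μ : Type) (D : ℕ)
  | mat (B : μ)
  | var (x : Fin D)
  | ctr (x : Fin D)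
  | num
  | idx
  | skipped
  | tmp
  | tmp'
  | flag
  | out
  | kbits
  | res
  deriving DecidableEq, Fintype

open Classical in
/-- The entries of a matrix in row-major order. -/
noncomputable def matList {n : ℕ} (R : Fin n → Fin n → Prop) : List (Option Bool) :=
  List.ofFn fun q : Fin (n * n) => some (decide (R q.divNat q.modNat))

@[simp]
theorem length_matList {n : ℕ} (R : Fin n → Fin n → Prop) : (matList R).length = n * n := by
  simp [matList]

theorem mul_add_lt {n : ℕ} (i j : Fin n) : (i : ℕ) * n + j < n * n :=
  calc (i : ℕ) * n + j < i * n + n := by omega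
    _ = (i + 1) * n := by ring
    _ ≤ n * n := Nat.mul_le_mul_right _ i.2

open Classical in
theorem getElem_matList {n : ℕ} (R : Fin n → Fin n → Prop) (i j : Fin n) :
    (matList R)[(i : ℕ) * n + j]'(by simpa using mul_add_lt i j) = some (decide (R i j)) := by
  have hn : 0 < n := i.pos
  have h1 : Fin.divNat (⟨(i : ℕ) * n + j, mul_add_lt i j⟩ : Fin (n * n)) = i := by
    ext
    simp only [Fin.divNat]
    rw [mul_comm, Nat.mul_add_div hn, Nat.div_eq_of_lt j.2, add_zero]
  have h2 : Fin.modNat (⟨(i : ℕ) * n + j, mul_add_lt i j⟩ : Fin (n * n)) = j := by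
    ext
    simp only [Fin.modNat]
    rw [mul_comm, Nat.mul_add_mod, Nat.mod_eq_of_lt j.2]
  simp only [matList, List.getElem_ofFn, h1, h2]

open Classical in
theorem matList_set {n : ℕ} (R : Fin n → Fin n → Prop) (i j : Fin n) (b : Bool) :
    (matList R).set ((i : ℕ) * n + j) (some b) =
      matList fun i' j' => if i' = i ∧ j' = j then b = true else R i' j' := by
  refine List.ext_getElem (by simp) fun q h1 h2 => ?_
  rw [List.getElem_set]
  have hq : q < n * n := by simpa using h2
  let q' : Fin (n * n) := ⟨q, hq⟩
  have hq' : q = (q'.divNat : ℕ) * n + q'.modNat := by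
    simp only [Fin.divNat, Fin.modNat, q']
    exact (Nat.div_add_mod' q n).symm
  have hn : 0 < n := i.pos
  have hiff : (i : ℕ) * n + j = q ↔ q'.divNat = i ∧ q'.modNat = j := by
    constructor
    · rintro rfl
      constructor <;> ext
      · simp only [Fin.divNat, q']
        rw [mul_comm, Nat.mul_add_div hn, Nat.div_eq_of_lt j.2, add_zero]
      · simp only [Fin.modNat, q']
        rw [mul_comm, Nat.mul_add_mod, Nat.mod_eq_of_lt j.2]
    · rintro ⟨hi, hj⟩
      rw [hq', hi, hj]
  have hR : ∀ R : Fin n → Fin n → Prop, ∀ h, (matList R)[q]'h =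
      some (decide (R q'.divNat q'.modNat)) := by
    intro R h
    simp [matList, q']
  rw [hR, hR]
  by_cases h : (i : ℕ) * n + j = q
  · simp [hiff.1 h, h]
  · have h' := fun h' => h (hiff.2 h')
    simp only [h, if_false]
    rw [if_neg h']

/-- The contents of the stacks: those determined by a state of a loop program, and others. -/
noncomputable def ProgState.put {μ : Type} {D n : ℕ} (s : ProgState μ n)
    (L : Key μ D → List (Option Bool)) : Key μ D → List (Option Bool)
  | .mat B => matList (s.mat B)
  | .flag => s.flags.map some
  | .out => s.out.reverse
  | k => L k

/-- The scratch stacks are empty, the size and the values of the variables in scope are in their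
places, and the stacks for the other variables are empty. -/
structure Frame {μ : Type} {D n d : ℕ} (hd : d ≤ D) (env : Fin d → Fin n)
    (L : Key μ D → List (Option Bool)) : Prop where
  num : L .num = List.replicate n none
  idx : L .idx = []
  skipped : L .skipped = []
  tmp : L .tmp = []
  tmp' : L .tmp' = []
  var : ∀ x : Fin d, L (.var (x.castLE hd)) = List.replicate (env x) none
  free : ∀ x : Fin D, d ≤ x → L (.var x) = [] ∧ L (.ctr x) = []

section

variable {μ : Type} [DecidableEq μ] {D n : ℕ}

theorem ProgState.update_put_mat (s : ProgState μ n) (L : Key μ D → List (Option Bool)) (B : μ)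
    (R : Fin n → Fin n → Prop) : Function.update (s.put L) (.mat B) (matList R) =
      ProgState.put { s with mat := Function.update s.mat B R } L := by
  funext k
  cases k <;> simp [ProgState.put, Function.update_apply]
  split_ifs <;> rfl

end

namespace Prog

variable {M : Turing.FinTM2} {μ : Type} [DecidableEq μ] {D : ℕ}

/-- Pushes on the stack `idx` the position of the matrix entry with row `x` and column `y`. -/
def index (x y : Fin D) : SubFrag M (Key μ D) :=
  Frag.seq (SubFrag.mulAdd (.var x) .num .idx .tmp .tmp') (SubFrag.copyRev (.var y) .idx .tmp)

theorem local_index (x y : Fin D) {n : ℕ} (i j : Fin n) (L : Key μ D → List (Option Bool))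
    (hn : L .num = List.replicate n none) (ht : L .tmp = []) (ht' : L .tmp' = [])
    (hi : L .idx = []) (hx : L (.var x) = List.replicate i none)
    (hy : L (.var y) = List.replicate j none) :
    SubFrag.Local (index x y : SubFrag M (Key μ D)) L
      (Function.update L .idx (List.replicate (i * n + j) none)) (5 * n * n + 11 * n + 4) := by
  refine ((SubFrag.local_mulAdd (by simp) (by simp) (by simp) (by simp) (by simp) (by simp)
    (by simp) (by simp) (by simp) (by simp) L ht ht' hx hn).seq
    (SubFrag.local_copyRev (by simp) (by simp) (by simp) _ (by simp [ht]))).of_eq ?_ ?_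
  · rw [Function.update_idem]
    simp [hi, hy, add_comm (j : ℕ)]
  · simp only [ne_eq, reduceCtorEq, not_false_eq_true, Function.update_of_ne, hy,
      List.length_replicate]
    have hin : (i : ℕ) * (5 * n + 6) ≤ n * (5 * n + 6) := Nat.mul_le_mul_right _ i.2.le
    have hj := j.2
    nlinarith

/-- The code of a loop program. -/
def compile : {d : ℕ} → (p : Prog μ d) → d + p.depth ≤ D → SubFrag M (Key μ D)
  | _, skip, _ => Frag.skip
  | _, seq p q, h => Frag.seq (p.compile (by simp only [depth] at h; omega))
      (q.compile (by simp only [depth] at h; omega))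
  | _, set B x y b, h => Frag.seq (index (x.castLE (by omega)) (y.castLE (by omega)))
      (SubFrag.writeAt .idx .skipped (.mat B) (some b))
  | _, ite B x y p q, h => Frag.seq (index (x.castLE (by omega)) (y.castLE (by omega)))
      (SubFrag.readAt .idx .skipped (.mat B) fun b =>
        if b then p.compile (by simp only [depth] at h; omega)
        else q.compile (by simp only [depth] at h; omega))
  | d, loop p, h => SubFrag.forVar .num (.ctr ⟨d, by simp only [depth] at h; omega⟩)
      (.var ⟨d, by simp only [depth] at h; omega⟩) .tmp
      (p.compile (by simp only [depth] at h; omega))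
  | _, pushFlag b, _ => SubFrag.push .flag (some b)
  | _, popFlag p q, h => SubFrag.pop .flag fun o =>
      if o = some (some true) then p.compile (by simp only [depth] at h; omega)
      else q.compile (by simp only [depth] at h; omega)
  | _, emit a, _ => SubFrag.push .out a

/-- Loop programs run in polynomial time. -/
theorem local_compile {d : ℕ} (p : Prog μ d) (h : d + p.depth ≤ D) :
    ∃ P : Polynomial ℕ, ∀ (n : ℕ) (env : Fin d → Fin n) (s : ProgState μ n)
      (L : Key μ D → List (Option Bool)), Frame (Nat.le_of_add_right_le h) env L →
      SubFrag.Local (p.compile h : SubFrag M (Key μ D)) (s.put L) ((p.run env s).put L)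
        (P.eval n) := by
  induction p with
  | skip => exact ⟨1, fun n env s L hL => (SubFrag.local_skip _).of_eq rfl (by simp)⟩
  | seq p q ihp ihq =>
    obtain ⟨P, hP⟩ := ihp (by simp only [depth] at h; omega)
    obtain ⟨Q, hQ⟩ := ihq (by simp only [depth] at h; omega)
    exact ⟨P + Q, fun n env s L hL => ((hP n env s L hL).seq (hQ n env _ L hL)).of_eq rfl
      (by simp)⟩
  | @set d B x y b =>
    refine ⟨10 * Polynomial.X ^ 2 + 11 * Polynomial.X + 8, fun n env s L hL => ?_⟩
    have h1 := local_index (M := M) (x.castLE (Nat.le_of_add_right_le h))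
      (y.castLE (Nat.le_of_add_right_le h)) (env x) (env y) (s.put L) hL.num hL.tmp hL.tmp' hL.idx
      (hL.var x) (hL.var y)
    have hlt : (env x : ℕ) * n + env y < (matList (s.mat B)).length := by
      simpa using mul_add_lt (env x) (env y)
    have hlen : ((matList (s.mat B)).take ((env x : ℕ) * n + env y)).length =
        (env x : ℕ) * n + env y := by
      rw [List.length_take, min_eq_left hlt.le]
    have h2 := SubFrag.local_writeAt (M := M) (κ := Key μ D) (i := .idx) (s := .skipped)
      (b := .mat B) (by simp) (by simp) (by simp)
      (L := Function.update (s.put L) .idx (List.replicate (env x * n + env y) none))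
      (pre := (matList (s.mat B)).take ((env x : ℕ) * n + env y))
      (post := (matList (s.mat B)).drop ((env x : ℕ) * n + env y + 1))
      (a := (matList (s.mat B))[(env x : ℕ) * n + env y]) (a' := some b)
      (by rw [hlen]; simp) (by simp [ProgState.put]) (by simp [ProgState.put, hL.skipped])
    refine (h1.seq h2).of_eq ?_ ?_
    · have hset := List.set_eq_take_append_cons_drop (l := matList (s.mat B))
        (i := (env x : ℕ) * n + env y) (a := some b)
      rw [if_pos hlt] at hset
      rw [← hset, matList_set, Function.update_idem]
      have h0 : Function.update (s.put L) Key.idx [] = s.put L := by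
        rw [← hL.idx]
        exact Function.update_eq_self _ _
      rw [h0, ProgState.update_put_mat, run]
    · rw [hlen]
      have := mul_add_lt (env x) (env y)
      simp
      nlinarith
  | @ite d B x y p q ihp ihq =>
    obtain ⟨P, hP⟩ := ihp (by simp only [depth] at h; omega)
    obtain ⟨Q, hQ⟩ := ihq (by simp only [depth] at h; omega)
    refine ⟨10 * Polynomial.X ^ 2 + 11 * Polynomial.X + 8 + P + Q, fun n env s L hL => ?_⟩
    have h1 := local_index (M := M) (x.castLE (Nat.le_of_add_right_le h))
      (y.castLE (Nat.le_of_add_right_le h)) (env x) (env y) (s.put L) hL.num hL.tmp hL.tmp' hL.idx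
      (hL.var x) (hL.var y)
    have hlt : (env x : ℕ) * n + env y < (matList (s.mat B)).length := by
      simpa using mul_add_lt (env x) (env y)
    have hlen : ((matList (s.mat B)).take ((env x : ℕ) * n + env y)).length =
        (env x : ℕ) * n + env y := by
      rw [List.length_take, min_eq_left hlt.le]
    have h2 := SubFrag.Local.readAt (M := M) (κ := Key μ D) (i := .idx) (s := .skipped)
      (b := .mat B) (by simp) (by simp) (by simp)
      (L := Function.update (s.put L) .idx (List.replicate (env x * n + env y) none))
      (L' := ((ite B x y p q).run env s).put L) (t := P.eval n + Q.eval n)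
      (pre := (matList (s.mat B)).take ((env x : ℕ) * n + env y))
      (post := (matList (s.mat B)).drop ((env x : ℕ) * n + env y + 1))
      (a := (matList (s.mat B))[(env x : ℕ) * n + env y])
      (c := fun b => if b then p.compile (by simp only [depth] at h; omega)
        else q.compile (by simp only [depth] at h; omega))
      (by rw [hlen]; simp) (by simp [ProgState.put]) (by simp [ProgState.put, hL.skipped])
      (by
        have h0 : Function.update (s.put L) Key.idx [] = s.put L := by
          rw [← hL.idx]
          exact Function.update_eq_self _ _
        rw [Function.update_idem, h0, getElem_matList, run]
        by_cases hB : s.mat B (env x) (env y)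
        · simp only [hB, decide_true, if_true]
          exact (hP n env s L hL).mono (by omega)
        · simp only [hB, decide_false, Option.some.injEq, Bool.false_eq_true, if_false]
          exact (hQ n env s L hL).mono (by omega))
    refine (h1.seq h2).of_eq rfl ?_
    rw [hlen]
    have := mul_add_lt (env x) (env y)
    simp
    nlinarith
  | @loop d p ih =>
    obtain ⟨P, hP⟩ := ih (by simp only [depth] at h; omega)
    have hdD : d < D := by simp only [depth] at h; omega
    refine ⟨Polynomial.X * (P + 9) + 4, fun n env s L hL => ?_⟩
    let st : ℕ → ProgState μ n := fun i => ((List.finRange n).take i).foldl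
      (fun s i => p.run (Fin.snoc (α := fun _ => Fin n) env i) s) s
    have h0 : st 0 = s := rfl
    have hn : st n = (loop p).run env s := by
      simp only [st, run]
      rw [List.take_of_length_le (by simp)]
    have hfree := hL.free ⟨d, hdD⟩ le_rfl
    have := SubFrag.Local.forVar (M := M) (κ := Key μ D) (m := .num) (c := .ctr ⟨d, hdD⟩)
      (v := .var ⟨d, hdD⟩) (t := .tmp) (by simp) (by simp) (by simp) (by simp) (n := n)
      (τ := P.eval n) (body := p.compile (by simp only [depth] at h; omega))
      (fun i => (st i).put L) hL.num hL.tmp hfree.1 hfree.2 hfree.1 hfree.2 (by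
        intro i hi
        have hupd : ∀ (s : ProgState μ n) (l l' : List (Option Bool)),
            Function.update (Function.update (s.put L) (.var ⟨d, hdD⟩) l) (.ctr ⟨d, hdD⟩) l' =
            s.put (Function.update (Function.update L (.var ⟨d, hdD⟩) l) (.ctr ⟨d, hdD⟩) l') := by
          intro s l l'
          funext k
          cases k <;> simp [ProgState.put, Function.update_apply]
        have hsucc : st (i + 1) =
            p.run (Fin.snoc (α := fun _ => Fin n) env ⟨i, hi⟩) (st i) := by
          simp only [st]
          rw [List.take_succ_eq_append_getElem (by simpa using hi), List.foldl_append]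
          simp
        rw [hupd, hupd, hsucc]
        refine hP n _ (st i) _ ⟨?_, ?_, ?_, ?_, ?_, ?_, ?_⟩
        · simpa using hL.num
        · simpa using hL.idx
        · simpa using hL.skipped
        · simpa using hL.tmp
        · simpa using hL.tmp'
        · intro x
          refine Fin.lastCases ?_ (fun x => ?_) x
          · have : (Fin.last d).castLE (Nat.le_of_add_right_le (n := d + 1) (k := p.depth) (by
                simp only [depth] at h; omega)) = ⟨d, hdD⟩ := rfl
            rw [this]
            simp
          · have hx := hL.var x
            have hne : x.castLE hdD.le ≠ ⟨d, hdD⟩ := fun h => by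
              have := congrArg Fin.val h
              have := x.2
              simp at *
              omega
            have : (x.castSucc).castLE (Nat.le_of_add_right_le (n := d + 1) (k := p.depth) (by
                simp only [depth] at h; omega)) = x.castLE hdD.le := rfl
            rw [this]
            simp [hne, hx]
        · intro x hx
          have hne : x ≠ ⟨d, hdD⟩ := fun h => by
            subst h
            simp at hx
          have := hL.free x (by omega)
          simp [hne, this])
    refine this.of_eq ?_ (by simp)
    rw [hn]
  | pushFlag b =>
    refine ⟨1, fun n env s L hL => (SubFrag.local_push _ _ _).of_eq ?_ (by simp)⟩
    funext k
    cases k <;> simp [ProgState.put, run]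
  | @popFlag d p q ihp ihq =>
    obtain ⟨P, hP⟩ := ihp (by simp only [depth] at h; omega)
    obtain ⟨Q, hQ⟩ := ihq (by simp only [depth] at h; omega)
    refine ⟨1 + (P + Q), fun n env s L hL => ?_⟩
    have h0 : Function.update (s.put L) .flag (s.put L .flag).tail =
        ProgState.put { s with flags := s.flags.tail } L := by
      funext k
      cases k <;> simp [ProgState.put]
    refine (SubFrag.Local.pop (L' := ((popFlag p q).run env s).put L) (t := P.eval n + Q.eval n)
      ?_).of_eq rfl (by simp)
    rw [h0]
    have hh : (s.put L .flag).head? = some (some true) ↔ s.flags.headD false = true := by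
      rcases hs : s.flags with _ | ⟨b, l⟩ <;> simp [ProgState.put, hs]
    simp only [hh, run]
    split_ifs
    · exact (hP n env _ L hL).mono (by omega)
    · exact (hQ n env _ L hL).mono (by omega)
  | emit a =>
    refine ⟨1, fun n env s L hL => (SubFrag.local_push _ _ _).of_eq ?_ (by simp)⟩
    funext k
    cases k <;> simp [ProgState.put, run]

end Prog

/-! ### First-order updates -/

/-- First-order formulas in binary relations with names in `ν`, with `d` free variables. The
quantifier binds the variable `d`. -/
inductive Fm (ν : Type) : ℕ → Type
  | rel {d : ℕ} (B : ν) (x y : Fin d) : Fm ν d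
  | not {d : ℕ} (φ : Fm ν d) : Fm ν d
  | and {d : ℕ} (φ ψ : Fm ν d) : Fm ν d
  | ex {d : ℕ} (φ : Fm ν (d + 1)) : Fm ν d

namespace Fm

/-- The truth value of a formula. -/
def eval {ν : Type} {n : ℕ} (m : ν → Fin n → Fin n → Prop) :
    {d : ℕ} → Fm ν d → (Fin d → Fin n) → Prop
  | _, rel B x y, env => m B (env x) (env y)
  | _, not φ, env => ¬ φ.eval m env
  | _, and φ ψ, env => φ.eval m env ∧ ψ.eval m env
  | _, ex φ, env => ∃ i, φ.eval m (Fin.snoc (α := fun _ => Fin n) env i)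

/-- Disjunction. -/
def or {ν : Type} {d : ℕ} (φ ψ : Fm ν d) : Fm ν d := not (and (not φ) (not ψ))

theorem eval_or {ν : Type} {n d : ℕ} (m : ν → Fin n → Fin n → Prop) (φ ψ : Fm ν d)
    (env : Fin d → Fin n) : (φ.or ψ).eval m env ↔ φ.eval m env ∨ ψ.eval m env := by
  simp only [or, eval]
  tauto

end Fm

namespace ProgState

/-- The state with one matrix replaced. -/
def withMat {μ : Type} [DecidableEq μ] {n : ℕ} (s : ProgState μ n) (X : μ)
    (R : Fin n → Fin n → Prop) : ProgState μ n :=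
  { s with mat := Function.update s.mat X R }

/-- The matrices other than the scratch matrix `none`. -/
def rels {ν : Type} {n : ℕ} (s : ProgState (Option ν) n) : ν → Fin n → Fin n → Prop :=
  fun B => s.mat (some B)

/-- What is left of a state when the matrices are ignored. -/
def rest {μ : Type} {n : ℕ} (s : ProgState μ n) : List Bool × List (Option Bool) :=
  (s.flags, s.out)

end ProgState

namespace Prog

/-- Executes `p` or `q` depending on the truth value of a formula. An existential quantifier is a
loop over all indices that raises a flag when a witness is found. -/
def cond {ν : Type} : {d : ℕ} → Fm ν d → Prog (Option ν) d → Prog (Option ν) d → Prog (Option ν) d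
  | _, .rel B x y, p, q => ite (some B) x y p q
  | _, .not φ, p, q => cond φ q p
  | _, .and φ ψ, p, q => cond φ (cond ψ p q) q
  | _, .ex φ, p, q => seq (pushFlag false) (seq
      (loop (cond φ (popFlag (pushFlag true) (pushFlag true)) skip)) (popFlag p q))

open Classical in
theorem run_cond {ν : Type} [DecidableEq ν] {n d : ℕ} (φ : Fm ν d) (p q : Prog (Option ν) d)
    (env : Fin d → Fin n) (s : ProgState (Option ν) n) :
    (cond φ p q).run env s = if φ.eval s.rels env then p.run env s else q.run env s := by
  induction φ generalizing s with
  | rel B x y => rfl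
  | not φ ih =>
    simp only [cond, ih, Fm.eval]
    by_cases h : φ.eval s.rels env <;> simp [h]
  | and φ ψ ihφ ihψ =>
    simp only [cond, ihφ, ihψ, Fm.eval]
    split_ifs with h1 h2 h3 <;> simp_all
  | @ex d φ ih =>
    have key : ∀ (l : List (Fin n)) (b : Bool),
        l.foldl (fun s i => (cond φ (popFlag (pushFlag true) (pushFlag true)) skip).run
          (Fin.snoc (α := fun _ => Fin n) env i) s) { s with flags := b :: s.flags } =
        { s with flags :=
          (b || decide (∃ i ∈ l, φ.eval s.rels (Fin.snoc (α := fun _ => Fin n) env i))) ::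
            s.flags } := by
      intro l
      induction l with
      | nil => simp
      | cons i l ihl =>
        intro b
        rw [List.foldl_cons, ih]
        have hr : ({ s with flags := b :: s.flags } : ProgState (Option ν) n).rels = s.rels := rfl
        rw [hr]
        split_ifs with h
        · have : ((popFlag (pushFlag true) (pushFlag true) : Prog (Option ν) (d + 1)).run
              (Fin.snoc (α := fun _ => Fin n) env i) { s with flags := b :: s.flags }) =
              { s with flags := true :: s.flags } := by
            simp [run]
          rw [this, ihl]
          simp [h]
        · have : ((skip : Prog (Option ν) (d + 1)).run
              (Fin.snoc (α := fun _ => Fin n) env i) { s with flags := b :: s.flags }) =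
              { s with flags := b :: s.flags } := rfl
          rw [this, ihl]
          simp [h]
    simp only [cond, run, key]
    simp only [List.mem_finRange, true_and, Bool.false_or, List.headD_cons, decide_eq_true_eq,
      List.tail_cons]
    by_cases h : (Fm.ex φ).eval s.rels env
    · rw [if_pos h]
      exact if_pos h
    · rw [if_neg h]
      exact if_neg h

/-- Replaces a matrix by the binary relation that a formula defines; the last two free variables
stand for row and column. The new matrix is built on the scratch matrix `none`, since the formula
may refer to the matrix that it replaces. -/
def assign {ν : Type} {d : ℕ} (B : ν) (φ : Fm ν (d + 2)) : Prog (Option ν) d :=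
  seq
    (loop (loop (cond φ (set none (Fin.last d).castSucc (Fin.last (d + 1)) true)
      (set none (Fin.last d).castSucc (Fin.last (d + 1)) false))))
    (loop (loop (ite none (Fin.last d).castSucc (Fin.last (d + 1))
      (set (some B) (Fin.last d).castSucc (Fin.last (d + 1)) true)
      (set (some B) (Fin.last d).castSucc (Fin.last (d + 1)) false))))

open Classical in
/-- A double loop that sets each entry of a matrix in turn replaces the matrix. -/
theorem run_loop_loop_fill {μ : Type} [DecidableEq μ] {n d : ℕ} (p : Prog μ (d + 2)) (X : μ)
    (env : Fin d → Fin n) (s : ProgState μ n) (c : Fin n → Fin n → Prop)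
    (h : ∀ R i j, p.run (Fin.snoc (α := fun _ => Fin n) (Fin.snoc (α := fun _ => Fin n) env i) j)
      (s.withMat X R) =
      s.withMat X fun a b => if a = i ∧ b = j then c i j else R a b) :
    (loop (loop p)).run env s = s.withMat X c := by
  have inner : ∀ (i : Fin n) (l : List (Fin n)) (R : Fin n → Fin n → Prop),
      l.foldl (fun s j => p.run (Fin.snoc (α := fun _ => Fin n)
        (Fin.snoc (α := fun _ => Fin n) env i) j) s) (s.withMat X R) =
      s.withMat X fun a b => if a = i ∧ b ∈ l then c a b else R a b := by
    intro i l
    induction l with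
    | nil => simp
    | cons j l ih =>
      intro R
      rw [List.foldl_cons, h, ih]
      congr 1
      funext a b
      by_cases ha : a = i
      · subst ha
        by_cases hb : b ∈ l
        · simp [hb]
        · by_cases hj : b = j
          · subst hj
            simp
          · simp [hb, hj]
      · simp [ha]
  have outer : ∀ (l : List (Fin n)) (R : Fin n → Fin n → Prop),
      l.foldl (fun s i => (loop p).run (Fin.snoc (α := fun _ => Fin n) env i) s) (s.withMat X R) =
      s.withMat X fun a b => if a ∈ l then c a b else R a b := by
    intro l
    induction l with
    | nil => simp
    | cons i l ih =>
      intro R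
      rw [List.foldl_cons, run, inner, ih]
      congr 1
      funext a b
      by_cases ha : a ∈ l
      · simp [ha]
      · simp [ha]
  have hs : s = s.withMat X (s.mat X) := by
    simp [ProgState.withMat]
  rw [run]
  conv_lhs => rw [hs]
  rw [outer]
  simp

theorem run_assign {ν : Type} [DecidableEq ν] {n d : ℕ} (B : ν) (φ : Fm ν (d + 2))
    (env : Fin d → Fin n) (s : ProgState (Option ν) n) :
    (assign B φ).run env s =
      let R := fun i j => φ.eval s.rels
        (Fin.snoc (α := fun _ => Fin n) (Fin.snoc (α := fun _ => Fin n) env i) j)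
      (s.withMat none R).withMat (some B) R := by
  classical
  rw [assign, run, run_loop_loop_fill _ none env s fun i j => φ.eval s.rels
    (Fin.snoc (α := fun _ => Fin n) (Fin.snoc (α := fun _ => Fin n) env i) j)]
  · rw [run_loop_loop_fill]
    intro R i j
    simp only [run, Fin.snoc_castSucc, Fin.snoc_last, ProgState.withMat]
    split_ifs with h
    · simp only [ne_eq, reduceCtorEq, not_false_eq_true, Function.update_of_ne,
        Function.update_self] at h
      simp [h]
    · simp only [ne_eq, reduceCtorEq, not_false_eq_true, Function.update_of_ne,
        Function.update_self] at h
      simp [h]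
  · intro R i j
    have hr : (s.withMat none R).rels = s.rels := by
      funext B
      simp [ProgState.rels, ProgState.withMat]
    rw [run_cond, hr]
    split_ifs with h
    · simp [run, ProgState.withMat, h]
    · simp [run, ProgState.withMat, h]

theorem run_seq {μ : Type} [DecidableEq μ] {n d : ℕ} (p q : Prog μ d) (env : Fin d → Fin n)
    (s : ProgState μ n) : (seq p q).run env s = q.run env (p.run env s) :=
  rfl

theorem rels_run_assign {ν : Type} [DecidableEq ν] {n d : ℕ} (B : ν) (φ : Fm ν (d + 2))
    (env : Fin d → Fin n) (s : ProgState (Option ν) n) :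
    ((assign B φ).run env s).rels = Function.update s.rels B fun i j => φ.eval s.rels
      (Fin.snoc (α := fun _ => Fin n) (Fin.snoc (α := fun _ => Fin n) env i) j) := by
  rw [run_assign]
  funext C
  by_cases h : C = B
  · subst h
    simp [ProgState.rels, ProgState.withMat]
  · simp [ProgState.rels, ProgState.withMat, h]

theorem rest_run_assign {ν : Type} [DecidableEq ν] {n d : ℕ} (B : ν) (φ : Fm ν (d + 2))
    (env : Fin d → Fin n) (s : ProgState (Option ν) n) :
    ((assign B φ).run env s).rest = s.rest := by
  rw [run_assign]
  rfl

/-- A relation `P` between abstract values and states is kept by a loop if its body acts on the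
values as `f`. -/
theorem run_loop_rel {μ α : Type} [DecidableEq μ] {n d : ℕ} {p : Prog μ (d + 1)}
    {env : Fin d → Fin n} (P : α → ProgState μ n → Prop) {f : α → Fin n → α}
    (h : ∀ i a s, P a s → P (f a i) (p.run (Fin.snoc (α := fun _ => Fin n) env i) s)) {a : α}
    {s : ProgState μ n} (hs : P a s) : P ((List.finRange n).foldl f a) (p.loop.run env s) := by
  have key : ∀ (l : List (Fin n)) (a : α) (s : ProgState μ n), P a s → P (l.foldl f a)
      (l.foldl (fun s i => p.run (Fin.snoc (α := fun _ => Fin n) env i) s) s) := by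
    intro l
    induction l with
    | nil => exact fun a s hs => hs
    | cons i l ih => exact fun a s hs => ih _ _ (h i a s hs)
  exact key _ a s hs

theorem run_loop_loop_rel {μ α : Type} [DecidableEq μ] {n d : ℕ} {p : Prog μ (d + 2)}
    {env : Fin d → Fin n} (P : α → ProgState μ n → Prop) {f : α → α}
    (h : ∀ i j a s, P a s → P (f a)
      (p.run (Fin.snoc (α := fun _ => Fin n) (Fin.snoc (α := fun _ => Fin n) env i) j) s)) {a : α}
    {s : ProgState μ n} (hs : P a s) : P (f^[n * n] a) (p.loop.loop.run env s) := by
  have key : ∀ (l : List (Fin n)) (g : α → α) a, l.foldl (fun a _ => g a) a = g^[l.length] a := by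
    intro l g
    induction l with
    | nil => exact fun a => rfl
    | cons i l ih => exact fun a => ih _
  have := run_loop_rel (env := env) P (f := fun a _ => (List.finRange n).foldl (fun a _ => f a) a)
    (fun i a s hs => run_loop_rel P (fun j a s hs => h i j a s hs) hs) hs
  simpa only [key, List.length_finRange, ← Function.iterate_mul] using this

end Prog

/-! ### The program that computes the tested sets -/

/-- The relations that the program computes: adjacency, equality, the bypass closure, reachability
around a vertex, the removed vertices and the tested sets. -/
inductive RelName
  | adj
  | eq
  | cl
  | reach
  | removed
  | tested
  deriving DecidableEq

instance : Fintype RelName where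
  elems := {.adj, .eq, .cl, .reach, .removed, .tested}
  complete x := by cases x <;> simp

namespace RelName

open Fm Prog

/-- Extends the walks by one step outside the closed neighbourhood of `w`, which is variable `2`.
Variables `5` and `6` are row and column; the others below `5` only count rounds. -/
def reachFm : Fm RelName 7 :=
  .or (.rel reach 5 6) (.ex (.and (.rel reach 5 7) (.and (.rel cl 7 6)
    (.and (.not (.rel adj 2 6)) (.not (.rel eq 2 6))))))

/-- Adds the ends of the bypasses around `w`, which is variable `2`. Variables `3` and `4` are row
and column. -/
def bypassFm : Fm RelName 5 :=
  .or (.rel cl 3 4) (.or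
    (.and (.rel cl 3 2) (.and (.rel cl 2 4) (.ex (.and (.rel reach 3 5) (.rel cl 5 4)))))
    (.and (.rel cl 4 2) (.and (.rel cl 2 3) (.ex (.and (.rel reach 4 5) (.rel cl 5 3))))))

/-- The vertex in variable `2` is simplicial in the remaining graph. Variable `3` does not occur, so
the formula defines a matrix with constant rows. -/
def simplicialFm : Fm RelName 4 :=
  .and (.not (.rel removed 2 2)) (.not (.ex (.ex (.and (.not (.rel removed 4 4))
    (.and (.not (.rel removed 5 5)) (.and (.rel cl 2 4) (.and (.rel cl 2 5)
      (.not (.rel cl 4 5)))))))))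

/-- Adds the ends of all bypasses around the vertex in variable `2`. -/
def bypassProg : Prog (Option RelName) 3 :=
  .seq (assign reach (.rel eq 3 4)) (.seq (.loop (.loop (assign reach reachFm)))
    (assign cl bypassFm))

/-- One round of elimination. -/
def elimProg : Prog (Option RelName) 2 :=
  .seq (assign tested (.or (.rel tested 2 3) (.and simplicialFm (.and (.not (.rel removed 3 3))
      (.rel cl 2 3)))))
    (assign removed (.or (.rel removed 2 3) simplicialFm))

/-- The computation of the tested sets. -/
def testedProg : Prog (Option RelName) 0 :=
  .seq (.loop (.set (some eq) 0 0 true)) (.seq (assign cl (.or (.rel adj 0 1) (.rel eq 0 1)))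
    (.seq (.loop (.loop (.loop bypassProg))) (.loop (.loop elimProg))))

variable {n : ℕ}

theorem eval_reachFm (m : RelName → Fin n → Fin n → Prop) (env : Fin 5 → Fin n) (u y : Fin n) :
    reachFm.eval m (Fin.snoc (α := fun _ => Fin n) (Fin.snoc (α := fun _ => Fin n) env u) y) ↔
      m reach u y ∨ ∃ x, m reach u x ∧ m cl x y ∧ ¬ m adj (env 2) y ∧ ¬ m eq (env 2) y := by
  simp only [reachFm, eval_or, eval]
  rfl

theorem eval_bypassFm (m : RelName → Fin n → Fin n → Prop) (env : Fin 3 → Fin n) (u v : Fin n) :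
    bypassFm.eval m (Fin.snoc (α := fun _ => Fin n) (Fin.snoc (α := fun _ => Fin n) env u) v) ↔
      addBypass (m cl) (m reach) (env 2) u v := by
  simp only [bypassFm, eval_or, eval]
  rfl

theorem eval_simplicialFm (m : RelName → Fin n → Fin n → Prop) (env : Fin 2 → Fin n)
    (u v : Fin n) :
    simplicialFm.eval m (Fin.snoc (α := fun _ => Fin n) (Fin.snoc (α := fun _ => Fin n) env u) v) ↔
      IsSimplicial (m cl) (m removed) u := by
  have : simplicialFm.eval m
      (Fin.snoc (α := fun _ => Fin n) (Fin.snoc (α := fun _ => Fin n) env u) v) ↔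
      ¬ m removed u u ∧ ¬ ∃ x y, ¬ m removed x x ∧ ¬ m removed y y ∧ m cl u x ∧ m cl u y ∧
        ¬ m cl x y := by
    simp only [simplicialFm, eval]
    rfl
  rw [this, IsSimplicial]
  push Not
  rfl

/-- What the program for the bypasses around a vertex does to all relations but `reach`. -/
theorem rels_run_bypassProg (G : SimpleGraph (Fin n)) (env : Fin 3 → Fin n)
    (s : ProgState (Option RelName) n) (hadj : s.rels adj = G.Adj) (heq : s.rels eq = Eq) :
    (∃ R, (bypassProg.run env s).rels = Function.update (Function.update s.rels reach R) cl
      (bypassStep G (s.rels cl) (env 2))) ∧ (bypassProg.run env s).rest = s.rest := by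
  have h1 : ((assign reach (.rel eq 3 4)).run env s).rels = Function.update s.rels reach Eq := by
    rw [rels_run_assign, ← heq]
    rfl
  have h2 := run_loop_loop_rel (p := assign reach reachFm) (env := env)
    (s := (assign reach (.rel eq 3 4)).run env s) (a := Eq)
    (f := reachStep G (s.rels cl) (env 2))
    (fun R s' => s'.rels = Function.update s.rels reach R ∧ s'.rest = s.rest) (by
      rintro i j R s' ⟨hs', hrest⟩
      refine ⟨?_, by rw [rest_run_assign, hrest]⟩
      rw [rels_run_assign, hs', Function.update_idem]
      congr 1
      funext u y
      rw [eval_reachFm]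
      simp only [Function.update_self, ne_eq, reduceCtorEq, not_false_eq_true,
        Function.update_of_ne, hadj, heq]
      rfl) ⟨h1, rest_run_assign _ _ _ _⟩
  refine ⟨⟨(reachStep G (s.rels cl) (env 2))^[n * n] Eq, ?_⟩, ?_⟩
  · simp only [bypassProg, run_seq, rels_run_assign]
    rw [h2.1]
    congr 1
    funext u v
    rw [eval_bypassFm]
    simp only [Function.update_self, ne_eq, reduceCtorEq, not_false_eq_true,
      Function.update_of_ne]
    rfl
  · simp only [bypassProg, run_seq, rest_run_assign]
    exact h2.2

theorem rels_run_elimProg (env : Fin 2 → Fin n) (s : ProgState (Option RelName) n) :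
    (elimProg.run env s).rels = Function.update (Function.update s.rels tested
      (elimStep (s.rels cl) (s.rels tested, s.rels removed)).1) removed
      (elimStep (s.rels cl) (s.rels tested, s.rels removed)).2 ∧
    (elimProg.run env s).rest = s.rest := by
  refine ⟨?_, ?_⟩
  · simp only [elimProg, run_seq, rels_run_assign]
    simp only [eval_or, eval, eval_simplicialFm]
    simp only [ne_eq, reduceCtorEq, not_false_eq_true, Function.update_of_ne]
    rfl
  · simp only [elimProg, run, rest_run_assign]

open Classical in
theorem foldl_diag (l : List (Fin n)) (E : Fin n → Fin n → Prop) (a b : Fin n) :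
    l.foldl (fun E i a b => if a = i ∧ b = i then true = true else E a b) E a b ↔
      (a = b ∧ a ∈ l) ∨ E a b := by
  induction l generalizing E with
  | nil => simp
  | cons i l ih =>
    rw [List.foldl_cons, ih]
    by_cases ha : a = i
    · subst ha
      by_cases hb : b = a
      · subst hb
        simp
      · simp [hb, Ne.symm hb]
    · simp [ha]

/-- The program computes the tested sets, from the adjacency matrix and empty matrices. -/
theorem run_testedProg (G : SimpleGraph (Fin n)) (s : ProgState (Option RelName) n)
    (env : Fin 0 → Fin n)
    (hadj : s.rels adj = G.Adj) (hs : ∀ B, B ≠ adj → s.rels B = fun _ _ => False) :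
    (testedProg.run env s).rels adj = G.Adj ∧
      (testedProg.run env s).rels tested = testedSets (bypassClosure G) ∧
      (testedProg.run env s).rest = s.rest := by
  classical
  have h1 := run_loop_rel (p := (set (some eq) 0 0 true : Prog (Option RelName) 1)) (env := env)
    (fun E s' => s'.rels = Function.update s.rels eq E ∧ s'.rest = s.rest)
    (f := fun E i a b => if a = i ∧ b = i then true = true else E a b)
    (a := fun _ _ => False) (s := s) (by
      rintro i E s' ⟨hs', hrest⟩
      refine ⟨?_, hrest⟩
      rw [← Function.update_idem (v := E), ← hs']
      funext B
      by_cases hB : B = eq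
      · subst hB
        have hE : s'.mat (some eq) = E := by
          have := congrFun hs' eq
          rwa [Function.update_self] at this
        simp [ProgState.rels, run, hE]
        rfl
      · simp [ProgState.rels, run, hB]) ⟨by rw [← hs eq (by simp), Function.update_eq_self], rfl⟩
  have hdiag : (List.finRange n).foldl
      (fun E i a b => if a = i ∧ b = i then true = true else E a b) (fun _ _ => False) =
      (Eq : Fin n → Fin n → Prop) := by
    funext a b
    rw [foldl_diag]
    simp
  rw [hdiag] at h1
  set s₁ := (loop (set (some eq) 0 0 true)).run env s with hs₁
  set s₂ := (assign cl (.or (.rel adj 0 1) (.rel eq 0 1))).run env s₁ with hs₂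
  have h2 : s₂.rels = Function.update s₁.rels cl fun u v => G.Adj u v ∨ u = v := by
    rw [hs₂, rels_run_assign]
    congr 1
    funext u v
    rw [eval_or]
    have e1 : s₁.rels adj = G.Adj := by rw [h1.1]; simp [hadj]
    have e2 : s₁.rels eq = Eq := by rw [h1.1]; simp
    simp only [eval, e1, e2]
    rfl
  have h3 := run_loop_loop_rel (p := loop bypassProg) (env := env) (s := s₂)
    (a := fun u v => G.Adj u v ∨ u = v) (f := bypassRound G)
    (fun F s' => s'.rels adj = G.Adj ∧ s'.rels eq = Eq ∧ s'.rels cl = F ∧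
      (s'.rels tested = fun _ _ => False) ∧ (s'.rels removed = fun _ _ => False) ∧
      s'.rest = s.rest) (by
      intro i j F s' hs'
      refine run_loop_rel (fun F s' => s'.rels adj = G.Adj ∧ s'.rels eq = Eq ∧ s'.rels cl = F ∧
        (s'.rels tested = fun _ _ => False) ∧ (s'.rels removed = fun _ _ => False) ∧
        s'.rest = s.rest) ?_ hs'
      rintro w F s' ⟨e1, e2, rfl, e4, e5, e6⟩
      obtain ⟨⟨R, hR⟩, hrest⟩ := rels_run_bypassProg G (Fin.snoc (α := fun _ => Fin n)
        (Fin.snoc (α := fun _ => Fin n) (Fin.snoc (α := fun _ => Fin n) env i) j) w) s' e1 e2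
      rw [hR, hrest]
      refine ⟨by simp [e1], by simp [e2], ?_, by simp [e4], by simp [e5], e6⟩
      rw [Function.update_self]
      rfl)
    ⟨by simp [h2, h1, hadj], by simp [h2, h1], by simp [h2], by simp [h2, h1, hs],
      by simp [h2, h1, hs], by rw [hs₂, rest_run_assign, h1.2]⟩
  have h4 := run_loop_loop_rel (p := elimProg) (env := env)
    (s := (loop (loop (loop bypassProg))).run env s₂) (a := (fun _ _ => False, fun _ _ => False))
    (f := elimStep (bypassClosure G))
    (fun S s' => s'.rels adj = G.Adj ∧ s'.rels cl = bypassClosure G ∧ s'.rels tested = S.1 ∧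
      s'.rels removed = S.2 ∧ s'.rest = s.rest) (by
      rintro i j ⟨S, D⟩ s' ⟨e1, e2, e3, e4, e5⟩
      have h := rels_run_elimProg (Fin.snoc (α := fun _ => Fin n)
        (Fin.snoc (α := fun _ => Fin n) env i) j) s'
      rw [h.1, h.2, e2, e3, e4]
      exact ⟨by simp [e1], by simp [e2], by simp, by simp, e5⟩)
    ⟨h3.1, h3.2.2.1, h3.2.2.2.1, h3.2.2.2.2.1, h3.2.2.2.2.2⟩
  exact ⟨h4.1, h4.2.2.1, h4.2.2.2.2⟩

/-! ### The subinstances -/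

/-- Outputs the adjacency matrix of the graph induced by the tested set number `0`. -/
def emitProg : Prog (Option RelName) 1 :=
  .loop (.ite (some tested) 0 1
    (.seq
      (.loop (.ite (some tested) 0 2
        (.ite (some adj) 1 2 (.emit (some true)) (.emit (some false))) .skip))
      (.emit none))
    .skip)

theorem run_loop_out {μ : Type} [DecidableEq μ] {d : ℕ} {p : Prog μ (d + 1)} {env : Fin d → Fin n}
    (s : ProgState μ n) (w : Fin n → List (Option Bool))
    (h : ∀ i o, p.run (Fin.snoc (α := fun _ => Fin n) env i) { s with out := o } =
      { s with out := o ++ w i }) (o : List (Option Bool)) :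
    p.loop.run env { s with out := o } = { s with out := o ++ (List.finRange n).flatMap w } := by
  have key : ∀ (l : List (Fin n)) o,
      l.foldl (fun s i => p.run (Fin.snoc (α := fun _ => Fin n) env i) s) { s with out := o } =
      { s with out := o ++ l.flatMap w } := by
    intro l
    induction l with
    | nil => simp
    | cons i l ih =>
      intro o
      rw [List.foldl_cons, h, ih]
      simp
  exact key _ o

open Classical in
theorem run_emitProg (env : Fin 1 → Fin n) (s : ProgState (Option RelName) n) :
    emitProg.run env s = ({ s with out := (s.out ++
      (((List.finRange n).filter fun i => s.rels tested (env 0) i).flatMap fun i =>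
        (((List.finRange n).filter fun j => s.rels tested (env 0) j).map
          fun j => some (decide (s.rels adj i j))) ++ [none])) } :
        ProgState (Option RelName) n) := by
  have hflat : ∀ (l : List (Fin n)) (q : Fin n → Prop) (w : Fin n → List (Option Bool)),
      (l.filter fun i => q i).flatMap w = l.flatMap fun i => if q i then w i else [] := by
    intro l q w
    induction l with
    | nil => rfl
    | cons i l ih =>
      by_cases hi : q i <;> simp [hi, ih]
  have hinner : ∀ (i : Fin n) (o : List (Option Bool)),
      (loop (ite (some tested) 0 2 (ite (some adj) 1 2 (emit (some true)) (emit (some false)))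
        skip) : Prog (Option RelName) 2).run (Fin.snoc (α := fun _ => Fin n) env i)
        { s with out := o } =
      ({ s with out := (o ++ ((List.finRange n).filter fun j => s.rels tested (env 0) j).map
          (fun j => some (decide (s.rels adj i j)))) } : ProgState (Option RelName) n) := by
    intro i o
    rw [run_loop_out s (fun j => if s.rels tested (env 0) j then [some (decide (s.rels adj i j))]
      else [])]
    · rw [← hflat, List.map_eq_flatMap]
    · intro j o
      have h0 : Fin.snoc (α := fun _ => Fin n) (Fin.snoc (α := fun _ => Fin n) env i) j 0 =
        env 0 := rfl
      have h1 : Fin.snoc (α := fun _ => Fin n) (Fin.snoc (α := fun _ => Fin n) env i) j 1 =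
        i := rfl
      have h2 : Fin.snoc (α := fun _ => Fin n) (Fin.snoc (α := fun _ => Fin n) env i) j 2 =
        j := rfl
      simp only [run, h0, h1, h2, ProgState.rels]
      by_cases ht : s.mat (some tested) (env 0) j
      · by_cases ha : s.mat (some adj) i j <;> simp [ht, ha]
      · simp [ht]
  rw [emitProg]
  have := run_loop_out (p := .ite (some tested) 0 1
    (.seq
      (.loop (.ite (some tested) 0 2
        (.ite (some adj) 1 2 (.emit (some true)) (.emit (some false))) .skip))
      (.emit none))
    .skip) (env := env) s (fun i => if s.rels tested (env 0) i then
      (((List.finRange n).filter fun j => s.rels tested (env 0) j).map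
          fun j => some (decide (s.rels adj i j))) ++ [none] else []) (by
      intro i o
      have h0 : Fin.snoc (α := fun _ => Fin n) env i 0 = env 0 := rfl
      have h1 : Fin.snoc (α := fun _ => Fin n) env i 1 = i := rfl
      rw [run, h0, h1]
      by_cases ht : s.rels tested (env 0) i
      · have ht' : s.mat (some tested) (env 0) i := ht
        rw [if_pos ht', if_pos ht, run_seq, hinner]
        simp [run]
      · have ht' : ¬ s.mat (some tested) (env 0) i := ht
        rw [if_neg ht', if_neg ht]
        simp [run]) s.out
  rw [this, hflat]

end RelName

theorem ColoringInstance.answer_eq (I : ColoringInstance) :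
    I.answer = true ↔ I.graph.Colorable I.k := by
  simp [answer, SimpleGraph.chromaticNumber_le_iff_colorable]

open Classical in
/-- The instance formed by an induced subgraph of a graph on `Fin n`, with the vertices numbered in
order. Its encoding is a part of the encoding of the whole graph. -/
theorem exists_subinstance {n : ℕ} (G : SimpleGraph (Fin n)) (S : Fin n → Prop) (k : ℕ) :
    ∃ I : ColoringInstance, Nonempty (I.graph ≃g G.induce {x | S x}) ∧ I.k = k ∧
      I.encode = (((List.finRange n).filter fun i => S i).flatMap fun i =>
        (((List.finRange n).filter fun j => S j).map fun j => some (decide (G.Adj i j))) ++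
          [none]) ++ (Computability.encodeNat k).map some := by
  set l := (List.finRange n).filter fun i => S i with hl
  have hnd : l.Nodup := (List.nodup_finRange n).filter _
  refine ⟨⟨l.length, G.comap l.get, k⟩, ⟨⟨(List.Nodup.getEquiv l hnd).trans
    (Equiv.subtypeEquivRight fun x => by simp [hl]), ?_⟩⟩, rfl, ?_⟩
  · intro a b
    rfl
  · have hget : ∀ {α : Type} (f : Fin n → α),
        l.map f = (List.finRange l.length).map fun i => f (l.get i) := by
      intro α f
      conv_lhs => rw [← List.map_get_finRange l]
      rw [List.map_map]
      rfl
    have hflat : ∀ (f : Fin n → List (Option Bool)),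
        l.flatMap f = (List.finRange l.length).flatMap fun i => f (l.get i) := by
      intro f
      rw [List.flatMap, hget, ← List.flatMap]
    rw [hflat]
    simp only [hget]
    rfl

/-! ### Reading the input -/

theorem rows_filter_isSome {n : ℕ} (a : Fin n → Fin n → Bool) :
    ((List.finRange n).flatMap fun i => (List.finRange n).map (fun j => some (a i j)) ++
      [none]).filter Option.isSome =
      (List.finRange n).flatMap fun i => (List.finRange n).map fun j => some (a i j) := by
  have key : ∀ l : List (Fin n), (l.flatMap fun i =>
      (List.finRange n).map (fun j => some (a i j)) ++ [none]).filter Option.isSome =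
      l.flatMap fun i => (List.finRange n).map fun j => some (a i j) := by
    intro l
    induction l with
    | nil => rfl
    | cons i l ih =>
      rw [List.flatMap_cons, List.filter_append, ih, List.filter_append, List.filter_eq_self.2]
      · simp
      · simp
  exact key _

theorem rows_filter_isNone {n : ℕ} (a : Fin n → Fin n → Bool) :
    ((List.finRange n).flatMap fun i => (List.finRange n).map (fun j => some (a i j)) ++
      [none]).filter Option.isNone = List.replicate n none := by
  have key : ∀ l : List (Fin n), (l.flatMap fun i =>
      (List.finRange n).map (fun j => some (a i j)) ++ [none]).filter Option.isNone =
      List.replicate l.length none := by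
    intro l
    induction l with
    | nil => rfl
    | cons i l ih =>
      rw [List.flatMap_cons, List.filter_append, ih, List.filter_append, List.filter_eq_nil_iff.2]
      · simp [List.replicate_succ]
      · simp
  rw [key, List.length_finRange]

open Classical in
theorem matList_eq_flatMap {n : ℕ} (R : Fin n → Fin n → Prop) : matList R =
    (List.finRange n).flatMap fun i => (List.finRange n).map fun j => some (decide (R i j)) := by
  rw [matList, List.ofFn_mul, List.flatMap, List.ofFn_eq_map]
  congr 2
  funext i
  rw [List.ofFn_eq_map]
  congr 1
  funext j
  have hn : 0 < n := i.pos
  congr 3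
  · ext
    simp only [Fin.divNat]
    rw [mul_comm, Nat.mul_add_div hn, Nat.div_eq_of_lt j.2, add_zero]
  · ext
    simp only [Fin.modNat]
    rw [mul_comm, Nat.mul_add_mod, Nat.mod_eq_of_lt j.2]

theorem matList_false (n : ℕ) :
    matList (fun _ _ : Fin n => False) = List.replicate (n * n) (some false) := by
  simp [matList]

namespace SubFrag

variable {M : Turing.FinTM2}

/-- The stacks of `M`, all empty but one. -/
def only (k : M.K) (w : List (M.Γ k)) : ∀ k, List (M.Γ k) :=
  Function.update (fun _ => []) k w

@[simp]
theorem only_self (k : M.K) (w : List (M.Γ k)) : only k w k = w := by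
  simp [only]

theorem only_of_ne {k k' : M.K} (h : k' ≠ k) (w : List (M.Γ k)) : only k w k' = [] := by
  simp [only, h]

@[simp]
theorem only_nil (k : M.K) : only k [] = fun _ => [] := by
  simp [only]

@[simp]
theorem update_only (k : M.K) (w w' : List (M.Γ k)) :
    Function.update (only k w) k w' = only k w' := by
  simp [only]

theorem only_eq_initList (w : List (M.Γ M.k₀)) : only M.k₀ w = (Turing.initList M w).stk := by
  funext k
  by_cases h : k = M.k₀
  · subst h
    simp [only, Turing.initList]
  · simp [only, Turing.initList, h]

theorem only_eq_haltList (w : List (M.Γ M.k₁)) : only M.k₁ w = (Turing.haltList M w).stk := by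
  funext k
  by_cases h : k = M.k₁
  · subst h
    simp [only, Turing.haltList]
  · simp [only, Turing.haltList, h]

variable {κ : Type} [DecidableEq κ]

/-- Moves the content of stack `k` of `M` to stack `b` outside `M`, reversing it. -/
def drain (k : M.K) (dec : M.Γ k → Option Bool) (b : κ) : SubFrag M κ :=
  Frag.loop (.inl k) dec (push b)

theorem runs_drain (k : M.K) (dec : M.Γ k → Option Bool) (b : κ) (w : List (M.Γ k))
    (L : κ → List (Option Bool)) :
    (drain k dec b).Runs (joinStk (only k w) L)
      (joinStk (fun _ => []) (Function.update L b ((w.map dec).reverse ++ L b)))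
      (2 * w.length + 1) := by
  induction w generalizing L with
  | nil =>
    have : Function.update L b ((List.map dec []).reverse ++ L b) = L := by simp
    rw [this, only_nil]
    exact Frag.Runs.loop_nil rfl
  | cons a w ih =>
    have hS : joinStk (only k (a :: w)) L (.inl k) = a :: w := by simp
    have h1 : (push b (dec a) : SubFrag M κ).Runs
        (Function.update (joinStk (only k (a :: w)) L) (.inl k) w)
        (joinStk (only k w) (Function.update L b (dec a :: L b))) 1 := by
      have := Frag.runs_push (σ := M.σ) (Γ := SubAlph M κ) (.inr b) (dec a)
        (joinStk (only k w) L)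
      rw [joinStk_inr, update_joinStk_inr] at this
      rw [update_joinStk_inl, update_only]
      exact this
    have h2 := ih (Function.update L b (dec a :: L b))
    rw [Function.update_idem, Function.update_self] at h2
    have h3 := Frag.Runs.loop_cons hS h1 h2
    have h4 : (w.map dec).reverse ++ dec a :: L b = ((a :: w).map dec).reverse ++ L b := by simp
    rw [h4] at h3
    refine h3.mono ?_
    simp only [List.length_cons]
    omega

/-- Moves the content of stack `b` outside `M` to stack `k` of `M`, reversing it. -/
def feed (b : κ) (k : M.K) (enc : Option Bool → M.Γ k) : SubFrag M κ :=
  Frag.loop (.inr b) id fun a => Frag.push (.inl k) (enc a)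

theorem runs_feed (b : κ) (k : M.K) (enc : Option Bool → M.Γ k) (w : List (M.Γ k))
    (L : κ → List (Option Bool)) :
    (feed b k enc).Runs (joinStk (only k w) L)
      (joinStk (only k ((L b).reverse.map enc ++ w)) (Function.update L b []))
      (2 * (L b).length + 1) := by
  induction hl : L b generalizing L w with
  | nil =>
    have : Function.update L b [] = L := by rw [← hl, Function.update_eq_self]
    rw [this]
    exact Frag.Runs.loop_nil hl
  | cons a l ih =>
    have hS : joinStk (only k w) L (.inr b) = a :: l := hl
    have h1 : (Frag.push (.inl k) (enc a) : SubFrag M κ).Runs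
        (Function.update (joinStk (only k w) L) (.inr b) l)
        (joinStk (only k (enc a :: w)) (Function.update L b l)) 1 := by
      have := Frag.runs_push (σ := M.σ) (Γ := SubAlph M κ) (.inl k) (enc a)
        (joinStk (only k w) (Function.update L b l))
      rw [joinStk_inl, update_joinStk_inl, only_self, update_only] at this
      rw [update_joinStk_inr]
      exact this
    have h2 := ih (enc a :: w) (Function.update L b l) (by simp)
    rw [Function.update_idem] at h2
    have h3 := Frag.Runs.loop_cons hS h1 h2
    have h4 : l.reverse.map enc ++ enc a :: w = (a :: l).reverse.map enc ++ w := by simp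
    rw [h4] at h3
    refine h3.mono ?_
    simp only [List.length_cons]
    omega

/-- Empties several stacks. -/
def clearAll : List κ → SubFrag M κ
  | [] => Frag.skip
  | k :: l => Frag.seq (clear k) (clearAll l)

theorem local_clearAll {B : ℕ} (l : List κ) (L : κ → List (Option Bool))
    (hL : ∀ k, (L k).length ≤ B) :
    Local (clearAll l : SubFrag M κ) L (fun k => if k ∈ l then [] else L k)
      (l.length * (2 * B + 1) + 1) := by
  induction l generalizing L with
  | nil => exact (local_skip L).of_eq (by simp) (by simp)
  | cons k l ih =>
    have h1 := ih (Function.update L k []) (fun j => by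
      by_cases h : j = k
      · subst h
        simp
      · simpa [h] using hL j)
    refine ((local_clear k L).seq h1).of_eq ?_ ?_
    · funext j
      by_cases h : j = k
      · subst h
        simp
      · simp [h]
    · have := hL k
      simp only [List.length_cons]
      ring_nf
      omega

variable {D : ℕ}

/-- Pushes the entry `b` on the adjacency matrix and the entry `false` on the other matrices of a
list. -/
def pushEntries (b : Bool) : List (Option RelName) → SubFrag M (Key (Option RelName) D)
  | [] => Frag.skip
  | B :: l => Frag.seq (push (.mat B) (some (if B = some .adj then b else false))) (pushEntries b l)

theorem local_pushEntries (b : Bool) (l : List (Option RelName)) (hl : l.Nodup)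
    (L : Key (Option RelName) D → List (Option Bool)) :
    Local (pushEntries b l : SubFrag M (Key (Option RelName) D)) L
      (fun k => match k with
        | .mat B => if B ∈ l then some (if B = some .adj then b else false) :: L (.mat B)
          else L (.mat B)
        | k => L k)
      (l.length + 1) := by
  induction l generalizing L with
  | nil =>
    refine (local_skip L).of_eq ?_ (by simp)
    funext k
    cases k <;> simp
  | cons B l ih =>
    obtain ⟨hB, hl⟩ := List.nodup_cons.1 hl
    refine ((local_push _ _ L).seq (ih hl _)).of_eq ?_ ?_
    · funext k
      cases k with
      | mat C =>
        by_cases h : C = B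
        · subst h
          simp [hB]
        · simp [h]
      | _ => simp
    · simp only [List.length_cons]
      omega

/-- Handles one letter of the rows of the adjacency matrix. -/
noncomputable def readLetter : Option Bool → SubFrag M (Key (Option RelName) D)
  | none => push .num none
  | some b => pushEntries b Finset.univ.toList

/-- What the stacks contain when the rows of the adjacency matrix, in reverse order and with the
marks, have been read from the stack `tmp`. -/
def afterRows (r : List (Option Bool)) (L : Key (Option RelName) D → List (Option Bool)) :
    Key (Option RelName) D → List (Option Bool)
  | .mat B => if B = some .adj then (r.filter Option.isSome).reverse ++ L (.mat B)
      else ((r.filter Option.isSome).map fun _ => some false).reverse ++ L (.mat B)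
  | .num => (r.filter Option.isNone).reverse ++ L .num
  | .tmp => []
  | k => L k

theorem local_readLetter (a : Option Bool) (r : List (Option Bool))
    (L : Key (Option RelName) D → List (Option Bool)) :
    ∃ L', Local (readLetter a : SubFrag M (Key (Option RelName) D)) (Function.update L .tmp r) L'
      (Fintype.card (Option RelName) + 1) ∧ L' .tmp = r ∧
        ∀ r', afterRows r' L' = afterRows (a :: r') L := by
  cases a with
  | none =>
    refine ⟨_, (local_push _ _ _).mono (by omega), by simp, fun r' => ?_⟩
    funext k
    cases k <;> simp [afterRows]
  | some b =>
    refine ⟨_, (local_pushEntries b _ (Finset.nodup_toList _) _).mono (by simp), by simp,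
      fun r' => ?_⟩
    funext k
    cases k with
    | mat B => by_cases hB : B = some .adj <;> simp [afterRows, hB]
    | _ => simp [afterRows]

/-- Reads the rows of the adjacency matrix from the stack `tmp`. -/
noncomputable def readRows : SubFrag M (Key (Option RelName) D) := loop .tmp readLetter

theorem local_readRows (r : List (Option Bool)) (L : Key (Option RelName) D → List (Option Bool))
    (hr : L .tmp = r) : Local (readRows : SubFrag M (Key (Option RelName) D)) L (afterRows r L)
      (r.length * (Fintype.card (Option RelName) + 2) + 1) := by
  induction r generalizing L with
  | nil =>
    refine (Local.loop_nil hr).of_eq ?_ (by simp)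
    funext k
    cases k <;> simp [afterRows, hr]
  | cons a r ih =>
    obtain ⟨L', h1, h2, h3⟩ := local_readLetter (M := M) a r L
    refine (Local.loop_cons hr h1 (ih L' h2)).of_eq (h3 r) ?_
    simp only [List.length_cons]
    ring_nf
    omega

/-- Reads the reversed input from the stack `tmp`: first the number of colors, and from the first
end-of-row mark on, the adjacency matrix. -/
noncomputable def readInput : SubFrag M (Key (Option RelName) D) :=
  loop .tmp fun a => a.elim (Frag.seq (push .num none) readRows) fun b => push .kbits (some b)

theorem local_readInput (r : List (Option Bool)) (hr : ∀ a ∈ r.head?, a = none) (ks : List Bool)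
    (L : Key (Option RelName) D → List (Option Bool)) (hL : L .tmp = ks.map some ++ r) :
    Local (readInput : SubFrag M (Key (Option RelName) D)) L
      (afterRows r (Function.update L .kbits ((ks.map some).reverse ++ L .kbits)))
      ((ks.length + r.length) * (Fintype.card (Option RelName) + 4) + 1) := by
  induction ks generalizing L with
  | nil =>
    cases r with
    | nil =>
      refine (Local.loop_nil hL).of_eq ?_ (by simp)
      funext k
      cases k <;> simp_all [afterRows]
    | cons a r =>
      obtain rfl : a = none := hr a rfl
      have h1 := local_readRows (M := M) (D := D) r
        (Function.update (Function.update L .tmp r) .num (none :: L .num)) (by simp)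
      have h2 := (local_push (M := M) .num none (Function.update L .tmp r)).seq h1
      refine (Local.loop_cons hL h2 (Local.loop_nil rfl)).of_eq ?_ ?_
      · funext k
        cases k <;> simp [afterRows]
      · simp only [List.length_nil, List.length_cons]
        ring_nf
        omega
  | cons b ks ih =>
    have h1 := ih (Function.update (Function.update L .tmp (ks.map some ++ r)) .kbits
      (some b :: L .kbits)) (by simp)
    refine (Local.loop_cons hL (t₁ := 1) ?_ h1).of_eq ?_ ?_
    · exact (local_push _ _ _).of_eq (by simp) le_rfl
    · funext k
      cases k <;> simp [afterRows]
    · simp only [List.length_cons]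
      ring_nf
      omega

end SubFrag

/-! ### The length of encodings -/

theorem Polynomial.eval_le_eval {m n : ℕ} (h : m ≤ n) (P : Polynomial ℕ) : P.eval m ≤ P.eval n := by
  rw [Polynomial.eval_eq_sum, Polynomial.eval_eq_sum]
  exact Finset.sum_le_sum fun i _ => Nat.mul_le_mul_left _ (Nat.pow_le_pow_left h i)

theorem length_rows {α β : Type} (l : List α) (l' : List β) (f : α → β → Option Bool) :
    (l.flatMap fun i => l'.map (f i) ++ [none]).length = l.length * (l'.length + 1) := by
  simp [List.length_flatMap]

theorem rows_getLast {n : ℕ} (f : Fin n → Fin n → Option Bool) (a : Option Bool)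
    (ha : a ∈ ((List.finRange n).flatMap fun i => (List.finRange n).map (f i) ++
      [none]).reverse.head?) : a = none := by
  cases n with
  | zero => simp at ha
  | succ n =>
    rw [List.finRange_succ_last, List.flatMap_append] at ha
    simpa [eq_comm] using ha

theorem ColoringInstance.length_encode (I : ColoringInstance) :
    I.encode.length = I.n * (I.n + 1) + (Computability.encodeNat I.k).length := by
  rw [encode, List.length_append, List.length_map, length_rows, List.length_finRange]

/-! ### The machine -/

section

variable {X : GraphClass} (h : Turing.TM2ComputableInPolyTime
    (fun I : {I : ColoringInstance // X (Fin I.n) I.graph} => I.1.encode)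
    Computability.encodeBool (fun I => I.1.answer))

/-- The stacks of the machine apart from those of the subroutine. Eight loop variables suffice. -/
abbrev Stack : Type := Key (Option RelName) 8

/-- Runs the given machine on the graph induced by the tested set of the vertex in the variable
`0`, and pushes a mark on the stack `res` if the answer is negative. -/
noncomputable def solveTested : SubFrag h.tm Stack :=
  Frag.seq (RelName.emitProg.compile (show 1 + 2 ≤ 8 by omega))
    (Frag.seq (SubFrag.copyRev .kbits .tmp' .tmp)
      (Frag.seq (SubFrag.feed .tmp' h.tm.k₀ h.inputAlphabet.invFun)
        (Frag.seq (SubFrag.feed .out h.tm.k₀ h.inputAlphabet.invFun)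
          (Frag.seq (callFrag h.tm Stack)
            (Frag.popCase (.inl h.tm.k₁) (fun a => some (h.outputAlphabet a))
              fun o => if o = some (some true) then Frag.skip else SubFrag.push .res none)))))

/-- If the program state yields the graph part `w` of the encoding of an instance `J` of the given
problem, then `solveTested` leaves everything unchanged except for a mark on `res` when the answer
to `J` is negative. -/
theorem local_solveTested : ∃ P : Polynomial ℕ, ∀ (n : ℕ) (env : Fin 1 → Fin n)
    (s : ProgState (Option RelName) n) (L : Stack → List (Option Bool))
    (w ks : List (Option Bool)) (J : ColoringInstance),
    Frame (show 1 ≤ 8 by omega) env L → s.out = [] →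
    RelName.emitProg.run env s = { s with out := w } →
    L .kbits = ks → X (Fin J.n) J.graph → J.encode = w ++ ks →
    SubFrag.Local (solveTested h) (s.put L)
      (s.put (if J.answer = true then L else Function.update L .res (none :: L .res)))
      (P.eval n + 10 * (w ++ ks).length + h.time.eval (w ++ ks).length + 10) := by
  obtain ⟨P, hP⟩ := RelName.emitProg.local_compile (M := h.tm) (D := 8) (show 1 + 2 ≤ 8 by omega)
  refine ⟨P, fun n env s L w ks J hL hout hrun hks hJ henc => ?_⟩
  have h1 := hP n env s L hL
  rw [hrun] at h1
  set s₁ : ProgState (Option RelName) n := { s with out := w } with hs₁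
  have h2 := SubFrag.local_copyRev (M := h.tm) (a := Key.kbits) (c := .tmp') (t := .tmp) (by simp)
    (by simp) (by simp) (s₁.put L) hL.tmp
  have h3 := SubFrag.runs_feed Key.tmp' h.tm.k₀ h.inputAlphabet.invFun [] (Function.update
    (s₁.put L) .tmp' ((s₁.put L .kbits).reverse ++ s₁.put L .tmp'))
  have e1 : s₁.put L Key.kbits = ks := hks
  have e2 : s₁.put L Key.tmp' = [] := hL.tmp'
  have e3 : Function.update (s₁.put L) Key.tmp' [] = s₁.put L := by
    rw [← e2, Function.update_eq_self]
  have e4 : s₁.put L Key.out = w.reverse := rfl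
  have e5 : Function.update (s₁.put L) Key.out [] = s.put L := by
    funext k
    cases k <;> simp [ProgState.put, hs₁, hout]
  rw [Function.update_idem, Function.update_self, e1, e2, e3, SubFrag.only_nil] at h3
  rw [e1, e2] at h2
  have h4 := SubFrag.runs_feed Key.out h.tm.k₀ h.inputAlphabet.invFun
    ((ks.reverse ++ []).reverse.map h.inputAlphabet.invFun ++ []) (s₁.put L)
  rw [e4, e5] at h4
  have e6 : w.reverse.reverse.map h.inputAlphabet.invFun ++
      ((ks.reverse ++ []).reverse.map h.inputAlphabet.invFun ++ []) =
      J.encode.map h.inputAlphabet.invFun := by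
    simp [henc]
  rw [e6, SubFrag.only_eq_initList (J.encode.map h.inputAlphabet.invFun)] at h4
  have h5 := runs_callFrag (κ := Stack) (h.outputsFun ⟨J, hJ⟩) (s.put L)
  have h6 : (Frag.popCase (.inl h.tm.k₁) (fun a => some (h.outputAlphabet a))
      fun o => if o = some (some true) then Frag.skip else SubFrag.push .res none :
        SubFrag h.tm Stack).Runs
      (joinStk (Turing.haltList h.tm ((Computability.encodeBool J.answer).map
        h.outputAlphabet.invFun)).stk (s.put L))
      (joinStk (fun _ => []) (s.put (if J.answer = true then L else
        Function.update L .res (none :: L .res)))) (1 + 1) := by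
    rw [← SubFrag.only_eq_haltList]
    refine Frag.Runs.popCase ?_
    rw [joinStk_inl, update_joinStk_inl, SubFrag.update_only, SubFrag.only_self]
    have e7 : ((Computability.encodeBool J.answer).map h.outputAlphabet.invFun).head?.map
        (fun a => some (h.outputAlphabet a)) = some (some J.answer) := by
      simp [Computability.encodeBool]
    have e8 : ((Computability.encodeBool J.answer).map h.outputAlphabet.invFun).tail = [] := rfl
    rw [e7, e8, SubFrag.only_nil]
    cases J.answer with
    | true =>
      rw [if_pos rfl, if_pos rfl]
      exact SubFrag.local_skip _
    | false =>
      rw [if_neg (by simp), if_neg (by simp)]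
      refine (SubFrag.local_push _ _ _).of_eq ?_ le_rfl
      funext k
      cases k <;> simp [ProgState.put]
  refine (h1.seq (h2.seq (h3.seq (h4.seq (h5.seq h6))))).mono ?_
  have e9 : h.time.eval (J.encode.length) = h.time.eval (w ++ ks).length := by rw [henc]
  simp only [e9, List.length_append, List.length_reverse, List.length_nil]
  omega

/-- Solves the coloring problem for a graph by solving it for the graphs induced by the tested
sets. In the end, all stacks but the output stack are cleared, as a halting configuration demands;
the answer is positive if and only if the stack `res` has remained empty. -/
noncomputable def solve : SubFrag h.tm Stack :=
  Frag.seq (Frag.seq (SubFrag.drain h.tm.k₀ h.inputAlphabet .tmp) SubFrag.readInput)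
    (Frag.seq (RelName.testedProg.compile (show 0 + 8 ≤ 8 by omega))
      (Frag.seq (SubFrag.forVar .num (.ctr 0) (.var 0) .tmp (solveTested h))
        (SubFrag.pop .res fun o => Frag.seq (SubFrag.clearAll Finset.univ.toList)
          (Frag.push (.inl h.tm.k₁) (h.outputAlphabet.invFun o.isNone)))))

/-- The program state when the input has been read. -/
def ColoringInstance.initState (I : ColoringInstance) : ProgState (Option RelName) I.n where
  mat B := if B = some .adj then I.graph.Adj else fun _ _ => False
  flags := []
  out := []

/-- The other stacks when the input has been read. -/
def ColoringInstance.initStk (I : ColoringInstance) : Stack → List (Option Bool)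
  | .num => List.replicate I.n none
  | .kbits => (Computability.encodeNat I.k).map some
  | _ => []

theorem runs_readInput (I : ColoringInstance) :
    (Frag.seq (SubFrag.drain h.tm.k₀ h.inputAlphabet .tmp) SubFrag.readInput :
      SubFrag h.tm Stack).Runs
      (joinStk (SubFrag.only h.tm.k₀ (I.encode.map h.inputAlphabet.invFun)) fun _ => [])
      (joinStk (fun _ => []) (I.initState.put I.initStk))
      (I.encode.length * (Fintype.card (Option RelName) + 6) + 2) := by
  classical
  set r := (List.finRange I.n).flatMap fun i => (List.finRange I.n).map
    (fun j => some (decide (I.graph.Adj i j))) ++ [none] with hr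
  set ks := Computability.encodeNat I.k with hks
  have henc : I.encode = r ++ ks.map some := by
    rw [ColoringInstance.encode]
  have h1 := SubFrag.runs_drain (κ := Stack) h.tm.k₀ h.inputAlphabet .tmp
    (I.encode.map h.inputAlphabet.invFun) fun _ => []
  have h2 := SubFrag.local_readInput (M := h.tm) (D := 8) r.reverse
    (rows_getLast fun i j => some (decide (I.graph.Adj i j))) ks.reverse
    (Function.update (fun _ => []) .tmp (((I.encode.map h.inputAlphabet.invFun).map
      h.inputAlphabet).reverse ++ [])) (by
        rw [Function.update_self, List.map_map]
        simp [henc, Function.comp_def])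
  have e : SubFrag.afterRows r.reverse (Function.update (Function.update (fun _ => []) .tmp
      (((I.encode.map h.inputAlphabet.invFun).map h.inputAlphabet).reverse ++ [])) .kbits
      ((ks.reverse.map some).reverse ++ [])) = I.initState.put I.initStk := by
    funext k
    have h3 : (r.filter Option.isSome) = matList I.graph.Adj := by
      rw [hr, rows_filter_isSome fun i j => decide (I.graph.Adj i j), matList_eq_flatMap]
    have h4 : r.filter Option.isNone = List.replicate I.n none :=
      rows_filter_isNone fun i j => decide (I.graph.Adj i j)
    cases k with
    | mat B =>
      by_cases hB : B = some .adj
      · simp [SubFrag.afterRows, ProgState.put, ColoringInstance.initState, hB, h3]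
      · simp only [SubFrag.afterRows, ProgState.put, ColoringInstance.initState, hB, if_false,
          matList_false, List.filter_reverse, h3]
        rw [List.map_const']
        simp
    | num => simp [SubFrag.afterRows, ProgState.put, ColoringInstance.initStk, h4]
    | _ => simp [SubFrag.afterRows, ProgState.put, ColoringInstance.initState,
        ColoringInstance.initStk, hks]
  have h2' := h2.of_eq e le_rfl
  refine (h1.seq h2').mono ?_
  simp only [List.length_map, List.length_reverse, henc, List.length_append]
  ring_nf
  omega

end

/-! ### Correctness and running time -/

section

variable {X : GraphClass} (h : Turing.TM2ComputableInPolyTime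
    (fun I : {I : ColoringInstance // X (Fin I.n) I.graph} => I.1.encode)
    Computability.encodeBool (fun I => I.1.answer))

open Classical in
/-- The record of the negative answers for the first `i` tested sets. -/
noncomputable def negMarks (I : ColoringInstance) (i : ℕ) : List (Option Bool) :=
  List.replicate (((List.finRange I.n).take i).countP fun v =>
    ¬ (I.graph.induce (testedSet I.graph v)).Colorable I.k) none

open Classical in
theorem negMarks_succ (I : ColoringInstance) (v : Fin I.n) :
    negMarks I (v + 1) = if (I.graph.induce (testedSet I.graph v)).Colorable I.k then
      negMarks I v else none :: negMarks I v := by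
  unfold negMarks
  rw [List.take_succ_eq_append_getElem (by simp), List.countP_append]
  split_ifs with hv
  · simp [hv]
  · simp [hv, List.replicate_succ]

theorem negMarks_eq_nil_iff (I : ColoringInstance) :
    negMarks I I.n = [] ↔ I.graph.Colorable I.k := by
  rw [colorable_iff_testedSet]
  simp [negMarks, List.take_of_length_le, List.countP_eq_zero]

/-- The fragment `solve` answers all instances with graphs in the C-closure, in polynomial time. The
tested sets induce graphs in the class, so the subroutine is only called on inputs for which it is
correct. -/
theorem runs_solve (hX : X.Hereditary) : ∃ Q : Polynomial ℕ, ∀ I : ColoringInstance,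
    CClosure X (Fin I.n) I.graph → (solve h).Runs
      (joinStk (SubFrag.only h.tm.k₀ (I.encode.map h.inputAlphabet.invFun)) fun _ => [])
      (joinStk (SubFrag.only h.tm.k₁ ((Computability.encodeBool I.answer).map
        h.outputAlphabet.invFun)) fun _ => []) (Q.eval I.encode.length) := by
  classical
  obtain ⟨P₁, hP₁⟩ := RelName.testedProg.local_compile (M := h.tm) (D := 8)
    (show 0 + 8 ≤ 8 by omega)
  obtain ⟨P₂, hP₂⟩ := local_solveTested h
  let c' := Fintype.card Stack
  refine ⟨Polynomial.X * Polynomial.C (Fintype.card (Option RelName) + 6) + 2 + P₁ +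
    (Polynomial.X * (P₂ + 10 * Polynomial.X + h.time + 19) + 4) +
    (3 + Polynomial.C c' * (2 * Polynomial.X + 1)), fun I hI => ?_⟩
  set N := I.encode.length with hN
  set ks := (Computability.encodeNat I.k).map some with hks
  have hlen : I.n * (I.n + 1) + ks.length = N := by
    rw [hN, I.length_encode, hks, List.length_map]
  -- `n`, `n * n` and the number of digits of `k` are at most the length of the input
  have hnN : I.n ≤ N := by nlinarith
  have hnnN : I.n * I.n ≤ N := by nlinarith
  have hksN : ks.length ≤ N := by omega
  have hframe : Frame (show 0 ≤ 8 by omega) (Fin.elim0 : Fin 0 → Fin I.n) I.initStk :=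
    ⟨rfl, rfl, rfl, rfl, rfl, fun x => x.elim0, fun x _ => ⟨rfl, rfl⟩⟩
  have h1 := hP₁ I.n Fin.elim0 I.initState I.initStk hframe
  obtain ⟨hadj, htested, hrest⟩ := RelName.run_testedProg I.graph I.initState Fin.elim0
    (by simp [ProgState.rels, ColoringInstance.initState])
    (fun B hB => by simp [ProgState.rels, ColoringInstance.initState, hB])
  set s := RelName.testedProg.run Fin.elim0 I.initState
  obtain ⟨hflags, hout⟩ : s.flags = [] ∧ s.out = [] := Prod.mk.injEq _ _ _ _ ▸ hrest
  set st : ℕ → Stack → List (Option Bool) := fun i =>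
    s.put (Function.update I.initStk .res (negMarks I i)) with hst
  have h2 := SubFrag.Local.forVar (M := h.tm) (κ := Stack) (m := .num) (c := .ctr 0) (v := .var 0)
    (t := .tmp) (by simp) (by simp) (by simp) (by simp) (n := I.n)
    (τ := P₂.eval N + 10 * N + h.time.eval N + 10) (body := solveTested h) st rfl rfl rfl rfl rfl
    rfl (by
      intro i hi
      have hupd : ∀ (L : Stack → List (Option Bool)) (l l' : List (Option Bool)),
          Function.update (Function.update (s.put L) (.var 0) l) (.ctr 0) l' =
          s.put (Function.update (Function.update L (.var 0) l) (.ctr 0) l') := by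
        intro L l l'
        funext k
        cases k <;> simp [ProgState.put, Function.update_apply]
      let v : Fin I.n := ⟨i, hi⟩
      obtain ⟨J, ⟨f⟩, hJk, hJ⟩ := exists_subinstance I.graph
        (testedSets (bypassClosure I.graph) v) I.k
      have hJX : X (Fin J.n) J.graph := hX _ _ _ _
        (induce_testedSet_mem hX hI v) ⟨f.toEmbedding⟩
      have hrun := RelName.run_emitProg (fun _ => v) s
      rw [hadj, htested, hout, List.nil_append] at hrun
      set w := ((List.finRange I.n).filter fun i =>
        testedSets (bypassClosure I.graph) v i).flatMap fun i => (((List.finRange I.n).filter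
          fun j => testedSets (bypassClosure I.graph) v j).map
            fun j => some (decide (I.graph.Adj i j))) ++ [none] with hw
      have hwN : (w ++ ks).length ≤ N := by
        rw [hw, List.length_append, length_rows, ← hlen]
        have : ((List.finRange I.n).filter fun i =>
            testedSets (bypassClosure I.graph) v i).length ≤ I.n :=
          (List.length_filter_le _ _).trans (by simp)
        gcongr
      have hJans : J.answer = true ↔ (I.graph.induce (testedSet I.graph v)).Colorable I.k := by
        rw [J.answer_eq, hJk]
        exact ⟨fun ⟨C⟩ => ⟨C.comp f.symm.toHom⟩, fun ⟨C⟩ => ⟨C.comp f.toHom⟩⟩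
      rw [hst, hupd, hupd]
      refine (hP₂ I.n (fun _ => v) s _ w ks J ⟨?_, ?_, ?_, ?_, ?_, ?_, ?_⟩ hout hrun ?_ hJX
        hJ).of_eq ?_ ?_
      · rfl
      · rfl
      · rfl
      · rfl
      · rfl
      · intro x
        obtain rfl := Subsingleton.elim x 0
        rfl
      · intro x hx
        have : x ≠ 0 := by
          rintro rfl
          simp at hx
        simp [this, ColoringInstance.initStk]
      · rfl
      · congr 1
        have hsucc := negMarks_succ I v
        simp only [hJans]
        funext k
        split_ifs at hsucc ⊢ with hcol
        · rw [show i + 1 = v + 1 from rfl, hsucc]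
        · rw [show i + 1 = v + 1 from rfl, hsucc]
          cases k <;> simp [Function.update_apply, v]
      · gcongr
        · exact Polynomial.eval_le_eval hnN P₂
        · exact Polynomial.eval_le_eval hwN h.time)
  have hst0 : st 0 = s.put I.initStk := by
    have : Function.update I.initStk .res (negMarks I 0) = I.initStk := by
      funext k
      cases k <;> simp [negMarks, ColoringInstance.initStk]
    exact congrArg s.put this
  rw [hst0] at h2
  -- no stack is longer than the input, so clearing all stacks takes polynomial time
  have hlenst : ∀ k, (st I.n k).length ≤ N := by
    intro k
    have hneg : (negMarks I I.n).length ≤ I.n := by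
      rw [negMarks, List.length_replicate]
      exact List.countP_le_length.trans (by simp)
    cases k with
    | mat B => simpa [hst, ProgState.put] using hnnN
    | num => simpa [hst, ProgState.put, ColoringInstance.initStk] using hnN
    | flag => simp [hst, ProgState.put, hflags]
    | out => simp [hst, ProgState.put, hout]
    | kbits => simpa [hst, ProgState.put, ColoringInstance.initStk, hks] using hksN
    | res => simpa [hst, ProgState.put] using hneg.trans hnN
    | _ => simp [hst, ProgState.put, ColoringInstance.initStk]
  have hans : (st I.n .res).head?.isNone = I.answer := by
    rw [Bool.eq_iff_iff, I.answer_eq, ← negMarks_eq_nil_iff]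
    simp [hst, ProgState.put, List.head?_eq_none_iff]
  have h3 := SubFrag.local_clearAll (M := h.tm) (B := N) Finset.univ.toList
    (Function.update (st I.n) .res (st I.n .res).tail) (fun k => by
      by_cases hk : k = .res
      · subst hk
        rw [Function.update_self, List.length_tail]
        exact (Nat.sub_le _ _).trans (hlenst _)
      · rw [Function.update_of_ne hk]
        exact hlenst k)
  have h4 := Frag.runs_push (σ := h.tm.σ) (Γ := SubAlph h.tm Stack) (.inl h.tm.k₁)
    (h.outputAlphabet.invFun I.answer) (joinStk (SubFrag.only h.tm.k₁ []) fun _ => [])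
  rw [joinStk_inl, update_joinStk_inl, SubFrag.update_only, SubFrag.only_self] at h4
  have h5 : (SubFrag.pop .res fun o => Frag.seq (SubFrag.clearAll Finset.univ.toList)
      (Frag.push (.inl h.tm.k₁) (h.outputAlphabet.invFun o.isNone)) :
        SubFrag h.tm Stack).Runs (joinStk (fun _ => []) (st I.n))
      (joinStk (SubFrag.only h.tm.k₁ ((Computability.encodeBool I.answer).map
        h.outputAlphabet.invFun)) fun _ => []) (1 + (c' * (2 * N + 1) + 1 + 1)) := by
    refine Frag.Runs.popCase ?_
    rw [joinStk_inr, update_joinStk_inr, Option.map_id]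
    refine Frag.Runs.seq (h3.of_eq (L'' := fun _ => []) (by simp) (by simp [c'])) ?_
    rw [id, hans]
    rw [SubFrag.only_nil] at h4
    exact h4
  have h0 := runs_readInput h I
  rw [← hN] at h0
  refine (h0.seq (Frag.Runs.seq h1 (Frag.Runs.seq h2 h5))).mono ?_
  have h6 := Polynomial.eval_le_eval hnN P₁
  have h7 : I.n * (P₂.eval N + 10 * N + h.time.eval N + 10 + 9) ≤
      N * (P₂.eval N + 10 * N + h.time.eval N + 19) :=
    Nat.mul_le_mul hnN (by omega)
  simp only [Polynomial.eval_add, Polynomial.eval_mul, Polynomial.eval_X, Polynomial.eval_C,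
    Polynomial.eval_ofNat, Polynomial.eval_one]
  omega

end

/-! ### From a fragment to a machine -/

/-- A fragment as a machine of its own. At its exit, the state is reset before the machine halts. -/
def SubFrag.toMachine {M : Turing.FinTM2} {κ : Type} [DecidableEq κ] [Fintype κ]
    (F : SubFrag M κ) : Turing.FinTM2 :=
  letI := M.kFin
  letI := M.σFin
  letI := M.Γk₀Fin
  { K := M.K ⊕ κ
    k₀ := .inl M.k₀
    k₁ := .inl M.k₁
    Γ := SubAlph M κ
    Λ := Option F.Λ
    main := some F.entry
    σ := M.σ × Option (Option Bool)
    initialState := (M.initialState, none)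
    m := fun o => o.elim (.load (fun _ => (M.initialState, none)) .halt) F.code }

theorem SubFrag.toMachine_outputs {M : Turing.FinTM2} {κ : Type} [DecidableEq κ] [Fintype κ]
    {F : SubFrag M κ} {w : List (M.Γ M.k₀)} {w' : List (M.Γ M.k₁)} {t : ℕ}
    (hF : F.Runs (joinStk (only M.k₀ w) fun _ => []) (joinStk (only M.k₁ w') fun _ => []) t) :
    Nonempty (Turing.TM2OutputsInTime F.toMachine w (some w') (t + 1)) := by
  obtain ⟨r', n, hn, h⟩ := hF (Option F.Λ) F.toMachine.m (fun l => l)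
    (fun l => (relabel_id _).symm) none
  have hinit : Turing.initList F.toMachine w =
      ⟨some (some F.entry), (M.initialState, none), joinStk (only M.k₀ w) fun _ => []⟩ := by
    refine congrArg (fun S => (⟨some (some F.entry), (M.initialState, none), S⟩ :
      Turing.TM2.Cfg (SubAlph M κ) (Option F.Λ) (M.σ × Option (Option Bool)))) ?_
    funext k
    rcases k with k | k
    · by_cases hk : k = M.k₀
      · subst hk
        exact (dif_pos rfl).trans (only_self M.k₀ w).symm
      · exact (dif_neg fun e => hk (Sum.inl.inj e)).trans (only_of_ne hk _).symm
    · exact dif_neg (by exact Sum.inr_ne_inl)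
  have hhalt : Turing.haltList F.toMachine w' =
      ⟨none, (M.initialState, none), joinStk (only M.k₁ w') fun _ => []⟩ := by
    refine congrArg (fun S => (⟨none, (M.initialState, none), S⟩ :
      Turing.TM2.Cfg (SubAlph M κ) (Option F.Λ) (M.σ × Option (Option Bool)))) ?_
    funext k
    rcases k with k | k
    · by_cases hk : k = M.k₁
      · subst hk
        exact (dif_pos rfl).trans (only_self M.k₁ w').symm
      · exact (dif_neg fun e => hk (Sum.inl.inj e)).trans (only_of_ne hk _).symm
    · exact dif_neg (by exact Sum.inr_ne_inl)
  refine ⟨⟨⟨n + 1, ?_⟩, show n + 1 ≤ t + 1 by omega⟩⟩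
  refine Eq.trans ?_ (congrArg some hhalt).symm
  rw [hinit, Function.iterate_succ_apply']
  exact (congrArg (flip bind F.toMachine.step) h).trans rfl

theorem theorem1 (X : GraphClass) (hX : EasyForColoring X) :
    EasyForColoring (CClosure X) := by
  obtain ⟨hX, ⟨h⟩⟩ := hX
  obtain ⟨Q, hQ⟩ := runs_solve h hX
  exact ⟨CClosure.hereditary hX, ⟨{
    tm := (solve h).toMachine
    inputAlphabet := h.inputAlphabet
    outputAlphabet := h.outputAlphabet
    time := Q + 1
    outputsFun := fun I => by
      have := (SubFrag.toMachine_outputs (hQ I.1 I.2)).some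
      rw [Polynomial.eval_add, Polynomial.eval_one]
      exact this }⟩⟩
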